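/- For integers $d\ge 2$, $k\ge 0$ and a real $B\ge 0$ let $$\mathcal H_{1,0}=\Big\{x\mapsto \langle w_a+w_b,x\rangle \;:\; w_a,w_b\in\mathbb R^d,\ \|w_a\|_1\le B,\ \|w_b\|_0\le k\Big\},$$ a class of real-valued predictors on the unit $\ell_\infty$ ball $\mathcal X=\{x\in\mathbb R^d:\|x\|_\infty\le 1\}$, where $\|w\|_0$ is the number of nonzero entries of $w$. For $h:\mathcal X\to\mathbb R$ and a Borel probability measure $\mathcal D$ on $\mathcal X\times\{\pm1\}$ let $\ell_{\mathrm{ramp}}(h,\mathcal D)=\mathbb E_{(x,y)\sim\mathcal D}\max(0,\min(1-h(x)y,1))$ be the expected ramp loss and $\ell_{\mathrm{ramp}}(\mathcal H_{1,0},\mathcal D)=\inf_{h\in\mathcal H_{1,0}}\ell_{\mathrm{ramp}}(h,\mathcal D)$. A learning algorithm $\mathcal A$, possibly randomized, maps each finite sample $S$ to a measurable predictor $\mathcal A(S):\mathcal X\to\mathbb R$. The sample complexity $m_{\mathcal H_{1,0}}(\epsilon,\delta)$ is the least $n$ for which there is an algorithm $\mathcal A$ such that for every $m\ge n$ and every $\mathcal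 D$, with probability at least $1-\delta$ over $m$ i.i.d. examples $S\sim\mathcal D^m$ and the internal randomness of $\mathcal A$, $\ell_{\mathrm{ramp}}(\mathcal A(S),\mathcal D)\le \ell_{\mathrm{ramp}}(\mathcal H_{1,0},\mathcal D)+\epsilon$. Theorem 2. For fixed $\delta\in(0,1)$, the sample complexity of $\mathcal H_{1,0}$ is $\tilde O\big((k\log d+B^2\log d)/\epsilon^2\big)$. That is, there is a universal constant $c\in\mathbb N$, and for every $\delta\in(0,1)$ a constant $C>0$ depending only on $\delta$, such that for all integers $d\ge2$, $k\ge0$ and all reals $B\ge0$, $\epsilon\in(0,1)$, with $R=(k\log d+B^2\log d)/\epsilon^2$, the sample complexity is finite and $$m_{\mathcal H_{1,0}}(\epsilon,\delta)\;\le\; C\,R\,\big(\log(2+R)\big)^{c}.$$ -/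

import Mathlib

open MeasureTheory

namespace RulesFirst

/-- The label set `{1, -1}`. -/
abbrev Label : Type := {y : ℝ // y = 1 ∨ y = -1}

/-- The truncation `max (0, min (r, 1))`. -/
noncomputable def clip (r : ℝ) : ℝ := max 0 (min r 1)

/-- The ramp loss of the prediction `yhat` on the label `y`. -/
noncomputable def rampLoss (yhat y : ℝ) : ℝ := clip (1 - yhat * y)

section Learning

variable {X : Type} [MeasurableSpace X]

/-- The expected ramp loss of the predictor `h` under the law `D` of a labelled example. -/
noncomputable def expLoss (h : X → ℝ) (D : Measure (X × Label)) : ℝ :=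
  ∫ z, rampLoss (h z.1) (z.2 : ℝ) ∂D

/-- The optimal expected ramp loss over the hypothesis class `H`. -/
noncomputable def optLoss (H : Set (X → ℝ)) (D : Measure (X × Label)) : ℝ :=
  ⨅ h : H, expLoss (h : X → ℝ) D

variable (X) in
/-- A (possibly randomized, possibly improper) learning algorithm. For each sample size `m` it maps
a sample and a random seed, drawn independently of the sample, to a real-valued predictor.
Measurability makes its success probability well defined. -/
structure Algorithm where
  Seed : Type
  [seedSpace : MeasurableSpace Seed]
  seedLaw : Measure Seed
  [seedProb : IsProbabilityMeasure seedLaw]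
  output : (m : ℕ) → (Fin m → X × Label) → Seed → X → ℝ
  measurable_output : ∀ m : ℕ, Measurable
    (fun p : ((Fin m → X × Label) × Seed) × X => output m p.1.1 p.1.2 p.2)

attribute [instance] Algorithm.seedSpace Algorithm.seedProb

/-- On samples of `m` i.i.d. examples, whatever their law `D`, the algorithm is `ε`-competitive
with the class `H` with probability at least `1 - δ` over the sample and the seed. -/
def Algorithm.Learns (A : Algorithm X) (H : Set (X → ℝ)) (ε δ : ℝ) (m : ℕ) : Prop :=
  ∀ D : Measure (X × Label), IsProbabilityMeasure D →
    1 - δ ≤ ((Measure.pi fun _ : Fin m => D).prod A.seedLaw).real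
      {p | expLoss (A.output m p.1 p.2) D ≤ optLoss H D + ε}

/-- The sample complexity of an algorithm with respect to `H`: the least `n` such that the
algorithm learns from `m` examples for every `m ≥ n` (and `⊤` if there is no such `n`). -/
noncomputable def Algorithm.sampleComplexity (A : Algorithm X) (H : Set (X → ℝ)) (ε δ : ℝ) : ℕ∞ :=
  sInf ((fun n : ℕ => (n : ℕ∞)) '' {n : ℕ | ∀ m : ℕ, n ≤ m → A.Learns H ε δ m})

/-- The sample complexity of the class `H`: the least one of an algorithm. -/
noncomputable def sampleComplexity (H : Set (X → ℝ)) (ε δ : ℝ) : ℕ∞ :=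
  ⨅ A : Algorithm X, A.sampleComplexity H ε δ

end Learning

/-- The unit ball of the supremum norm in dimension `d`. -/
abbrev Cube (d : ℕ) : Type := {x : Fin d → ℝ // ∀ j, |x j| ≤ 1}

/-- Linear predictors on the unit `ℓ∞` ball whose weight is the sum of a vector of `ℓ1` norm at
most `B` and a vector with at most `k` nonzero entries. -/
def H10 (d k : ℕ) (B : ℝ) : Set (Cube d → ℝ) :=
  {h | ∃ wa wb : Fin d → ℝ, ∑ j, |wa j| ≤ B ∧ {j | wb j ≠ 0}.ncard ≤ k ∧
    h = fun x => ∑ j, (wa j + wb j) * x.1 j}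

/-- The quantity `(k log d + B² log d) / ε²`. -/
noncomputable def rate (d k : ℕ) (B ε : ℝ) : ℝ :=
  (k * Real.log d + B ^ 2 * Real.log d) / ε ^ 2

end RulesFirst

/-! The learner is approximate empirical risk minimization over a countable sup-norm dense sequence
in the class. Symmetrization with a ghost sample (`generalization_gap_le`) bounds its expected
excess risk by a Rademacher average of the ramp losses, and Markov's inequality turns this into
probability `1 - δ`. Markov costs a polynomial factor in `1 / δ`, which the constant absorbs because
`δ` is fixed.

The Rademacher average is bounded in `signAvg_rampLoss_le`. With the sparse part frozen, it is a
fixed offset at each sample point, and the ramp loss is 1-Lipschitz in the `ℓ1` part. Contraction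
therefore reduces to the `ℓ1` ball, which costs `B² log d`. The sparse part is then handled by a
finite union. Since the `ℓ1` part is bounded by `B`, the loss is constant once the offset leaves
`[-(B+1), B+1]`, so up to an error `τ` only the position of each offset relative to a grid of step
`τ` matters. After choosing at most `k` coordinates, the grid patterns on the sample are traces of
halfspaces, which Sauer-Shelah counts (`exists_threshold_cover`). Bounded differences make the union
cost only the logarithm of this count (`signAvg_union_le`), which is `k log d` up to logarithmic
factors.

Suprema over the class are replaced throughout by selections, that is, arbitrary functions of the
sign pattern. This avoids measurability and boundedness questions for suprema, and it suits
symmetrization, where the chosen predictor depends on the swapped sample. -/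

namespace RulesFirst

/-! ### Sign averages and their exponential moments -/

/-- The sign `1` or `-1` encoded by a Boolean. -/
def sgn (b : Bool) : ℝ := if b then 1 else -1

lemma sgn_not (b : Bool) : sgn (!b) = -sgn b := by cases b <;> simp [sgn]

lemma sgn_eq_or (b : Bool) : sgn b = 1 ∨ sgn b = -1 := by cases b <;> simp [sgn]

/-- The average over all sign patterns. -/
noncomputable def signAvg {m : ℕ} (F : (Fin m → Bool) → ℝ) : ℝ := (∑ σ, F σ) / 2 ^ m

lemma signAvg_mono {m : ℕ} {F G : (Fin m → Bool) → ℝ} (h : ∀ σ, F σ ≤ G σ) :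
    signAvg F ≤ signAvg G := by
  unfold signAvg
  gcongr with σ
  exact h σ

lemma signAvg_add {m : ℕ} (F G : (Fin m → Bool) → ℝ) :
    signAvg (fun σ => F σ + G σ) = signAvg F + signAvg G := by
  simp [signAvg, Finset.sum_add_distrib, add_div]

lemma signAvg_const_mul {m : ℕ} (c : ℝ) (F : (Fin m → Bool) → ℝ) :
    signAvg (fun σ => c * F σ) = c * signAvg F := by
  simp [signAvg, ← Finset.mul_sum, mul_div_assoc]

lemma signAvg_const {m : ℕ} (c : ℝ) : signAvg (fun _ : Fin m → Bool => c) = c := by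
  simp [signAvg]

lemma signAvg_sum {m : ℕ} {ι : Type*} (s : Finset ι) (F : ι → (Fin m → Bool) → ℝ) :
    signAvg (fun σ => ∑ i ∈ s, F i σ) = ∑ i ∈ s, signAvg (F i) := by
  simp only [signAvg]
  rw [Finset.sum_comm, Finset.sum_div]

lemma signAvg_succ {n : ℕ} (F : (Fin (n + 1) → Bool) → ℝ) :
    signAvg F = (signAvg (fun σ : Fin n → Bool => F (Fin.cons true σ)) +
      signAvg (fun σ : Fin n → Bool => F (Fin.cons false σ))) / 2 := by
  unfold signAvg
  rw [← (Fin.consEquiv (fun _ : Fin (n + 1) => Bool)).sum_comp, Fintype.sum_prod_type]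
  simp only [Fintype.sum_bool]
  rw [pow_succ]
  field_simp
  rfl

/-- Negating all signs preserves the average. -/
lemma signAvg_comp_not {m : ℕ} (F : (Fin m → Bool) → ℝ) :
    signAvg (fun σ => F (fun i => !σ i)) = signAvg F := by
  unfold signAvg
  congr 1
  refine Fintype.sum_bijective (fun σ i => !σ i) ?_ _ _ (fun _ => rfl)
  exact Function.Involutive.bijective (fun σ => by simp)

lemma exp_signAvg_le {m : ℕ} (F : (Fin m → Bool) → ℝ) :
    Real.exp (signAvg F) ≤ signAvg (fun σ => Real.exp (F σ)) := by
  have h := convexOn_exp.map_sum_le (t := Finset.univ) (w := fun _ : Fin m → Bool => (1 : ℝ) / 2 ^ m)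
    (p := F) (fun _ _ => by positivity) (by simp) (fun _ _ => Set.mem_univ _)
  simp only [smul_eq_mul, ← Finset.mul_sum] at h
  unfold signAvg
  rwa [div_eq_mul_one_div, mul_comm, div_eq_mul_one_div (∑ σ, Real.exp (F σ)), mul_comm (∑ σ, _)]

/-- Factoring out the midpoint leaves a hyperbolic cosine, and `cosh x ≤ exp (x² / 2)`. This is the
contribution of a single sign to the bounded differences inequality. -/
lemma two_point_exp_le {a b c : ℝ} (h : |a - b| ≤ 2 * c) :
    (Real.exp a + Real.exp b) / 2 ≤ Real.exp ((a + b) / 2 + c ^ 2 / 2) := by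
  have h1 : (Real.exp a + Real.exp b) / 2 = Real.exp ((a + b) / 2) * Real.cosh ((a - b) / 2) := by
    rw [Real.cosh_eq, mul_div_assoc', mul_add, ← Real.exp_add, ← Real.exp_add]
    ring_nf
  rw [h1, Real.exp_add]
  gcongr
  refine (Real.cosh_le_exp_half_sq _).trans (Real.exp_le_exp.2 ?_)
  have : ((a - b) / 2) ^ 2 ≤ c ^ 2 :=
    sq_le_sq' (by linarith [(abs_le.1 h).1]) (by linarith [(abs_le.1 h).2])
  linarith

/-- Bounded differences inequality for the moment generating function on the sign cube. -/
lemma signAvg_exp_le (l : ℝ) (hl : 0 ≤ l) : ∀ {n : ℕ} (F : (Fin n → Bool) → ℝ),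
    (∀ σ i, |F (Function.update σ i true) - F (Function.update σ i false)| ≤ 2) →
    signAvg (fun σ => Real.exp (l * F σ)) ≤ Real.exp (l * signAvg F + l ^ 2 * n / 2)
  | 0, F, _ => by simp [signAvg]
  | n + 1, F, hF => by
    have ih : ∀ b : Bool, signAvg (fun σ : Fin n → Bool => Real.exp (l * F (Fin.cons b σ))) ≤
        Real.exp (l * signAvg (fun σ : Fin n → Bool => F (Fin.cons b σ)) + l ^ 2 * n / 2) := by
      intro b
      refine signAvg_exp_le l hl (fun σ : Fin n → Bool => F (Fin.cons b σ)) ?_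
      intro σ i
      have := hF (Fin.cons b σ) i.succ
      rwa [← Fin.cons_update, ← Fin.cons_update] at this
    rw [signAvg_succ, signAvg_succ F]
    set p := signAvg (fun σ : Fin n → Bool => F (Fin.cons true σ))
    set q := signAvg (fun σ : Fin n → Bool => F (Fin.cons false σ))
    -- Averaging over the remaining signs preserves the difference bound in the first sign.
    have hpq : |p - q| ≤ 2 := by
      have e : ∀ (σ : Fin n → Bool), |F (Fin.cons true σ) - F (Fin.cons false σ)| ≤ 2 := by
        intro σ
        have := hF (Fin.cons true σ) 0
        rwa [Fin.update_cons_zero, Fin.update_cons_zero] at this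
      have h1 : p ≤ 2 + q := by
        have := signAvg_mono (F := fun σ : Fin n → Bool => F (Fin.cons true σ))
          (G := fun σ => 2 + F (Fin.cons false σ)) (fun σ => by linarith [abs_le.1 (e σ)])
        rwa [signAvg_add (fun _ => 2), signAvg_const] at this
      have h2 : q ≤ 2 + p := by
        have := signAvg_mono (F := fun σ : Fin n → Bool => F (Fin.cons false σ))
          (G := fun σ => 2 + F (Fin.cons true σ)) (fun σ => by linarith [abs_le.1 (e σ)])
        rwa [signAvg_add (fun _ => 2), signAvg_const] at this
      rw [abs_le]; constructor <;> linarith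
    have h2 : |l * p - l * q| ≤ 2 * l := by
      rw [← mul_sub, abs_mul, abs_of_nonneg hl]; nlinarith
    calc _ ≤ (Real.exp (l * p + l ^ 2 * n / 2) + Real.exp (l * q + l ^ 2 * n / 2)) / 2 := by
          gcongr
          · exact ih true
          · exact ih false
      _ = (Real.exp (l * p) + Real.exp (l * q)) / 2 * Real.exp (l ^ 2 * n / 2) := by
          rw [Real.exp_add, Real.exp_add]; ring
      _ ≤ Real.exp ((l * p + l * q) / 2 + l ^ 2 / 2) * Real.exp (l ^ 2 * n / 2) := by
          gcongr
          exact two_point_exp_le h2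
      _ = _ := by
          rw [← Real.exp_add]; congr 1; push_cast; ring

/-- Maximal inequality: a selection among finitely many functions whose exponential moments are
bounded has a small average. -/
lemma signAvg_selection_le {m : ℕ} {W : Type*} [Fintype W] (Z : W → (Fin m → Bool) → ℝ)
    {l K : ℝ} (hl : 0 < l) (hK : ∀ v, signAvg (fun σ => Real.exp (l * Z v σ)) ≤ Real.exp K)
    (s : (Fin m → Bool) → W) :
    signAvg (fun σ => Z (s σ) σ) ≤ (Real.log (Fintype.card W) + K) / l := by
  classical
  have hW : 0 < (Fintype.card W : ℝ) := by
    have : Nonempty W := ⟨s (fun _ => true)⟩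
    exact_mod_cast Fintype.card_pos
  rw [le_div_iff₀ hl, mul_comm, ← signAvg_const_mul]
  rw [← Real.exp_le_exp, Real.exp_add, Real.exp_log hW]
  -- Jensen moves the exponential inside; the selected exponential is then at most the sum of all of
  -- them, which no longer depends on the selection.
  calc _ ≤ signAvg (fun σ => Real.exp (l * Z (s σ) σ)) := exp_signAvg_le _
    _ ≤ signAvg (fun σ => ∑ v, Real.exp (l * Z v σ)) :=
        signAvg_mono fun σ => Finset.single_le_sum (f := fun v => Real.exp (l * Z v σ))
          (fun v _ => (Real.exp_pos _).le) (Finset.mem_univ (s σ))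
    _ = ∑ v, signAvg (fun σ => Real.exp (l * Z v σ)) := signAvg_sum _ _
    _ ≤ ∑ v : W, Real.exp K := Finset.sum_le_sum fun v _ => hK v
    _ = _ := by simp

/-! ### Contraction -/

/-- One step of the contraction principle, for selections instead of suprema. -/
lemma exists_selection_contraction_step {m : ℕ} {T : Type*} (i₀ : Fin m) (g g' : T → Fin m → ℝ)
    (hne : ∀ t i, i ≠ i₀ → g' t i = g t i)
    (hle : ∀ t t', |g t i₀ - g t' i₀| ≤ |g' t i₀ - g' t' i₀|) (s : (Fin m → Bool) → T) :
    ∃ s' : (Fin m → Bool) → T, ∑ σ, ∑ i, sgn (σ i) * g (s σ) i ≤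
      ∑ σ, ∑ i, sgn (σ i) * g' (s' σ) i := by
  classical
  let flip : (Fin m → Bool) → Fin m → Bool := fun σ => Function.update σ i₀ (!σ i₀)
  have hinv : Function.Involutive flip := by
    intro σ; ext i; by_cases h : i = i₀
    · subst h; simp [flip]
    · simp [flip, h]
  have hf0 : ∀ σ, sgn (flip σ i₀) = -sgn (σ i₀) := fun σ => by simp [flip, sgn_not]
  let rest : (Fin m → Bool) → T → ℝ := fun σ t => ∑ i ∈ Finset.univ.erase i₀, sgn (σ i) * g t i
  have hrest : ∀ σ t, rest (flip σ) t = rest σ t := by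
    intro σ t
    refine Finset.sum_congr rfl fun i hi => ?_
    simp [flip, Finset.ne_of_mem_erase hi]
  have hg : ∀ σ t, ∑ i, sgn (σ i) * g t i = sgn (σ i₀) * g t i₀ + rest σ t := fun σ t =>
    (Finset.add_sum_erase _ _ (Finset.mem_univ i₀)).symm
  have hg' : ∀ σ t, ∑ i, sgn (σ i) * g' t i = sgn (σ i₀) * g' t i₀ + rest σ t := fun σ t => by
    rw [← Finset.add_sum_erase _ _ (Finset.mem_univ i₀)]
    congr 1
    exact Finset.sum_congr rfl fun i hi => by rw [hne t i (Finset.ne_of_mem_erase hi)]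
  -- Sign patterns are paired by flipping sign `i₀`. Within a pair the two choices are exchanged if
  -- needed, so that the pair contributes `|g' - g'|` at `i₀`, which dominates the original
  -- difference. The test takes the same value on both members (`hcond`), so the exchange is
  -- consistent.
  let s' : (Fin m → Bool) → T := fun σ =>
    if 0 ≤ sgn (σ i₀) * (g' (s σ) i₀ - g' (s (flip σ)) i₀) then s σ else s (flip σ)
  have hcond : ∀ σ, sgn (flip σ i₀) * (g' (s (flip σ)) i₀ - g' (s (flip (flip σ))) i₀) =
      sgn (σ i₀) * (g' (s σ) i₀ - g' (s (flip σ)) i₀) := by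
    intro σ; rw [hinv σ, hf0]; ring
  refine ⟨s', ?_⟩
  have hdouble : ∀ Φ : (Fin m → Bool) → ℝ, ∑ σ, Φ σ = (∑ σ, (Φ σ + Φ (flip σ))) / 2 := by
    intro Φ
    rw [Finset.sum_add_distrib, Function.Bijective.sum_comp hinv.bijective Φ]; ring
  rw [hdouble, hdouble (fun σ => ∑ i, sgn (σ i) * g' (s' σ) i)]
  refine div_le_div_of_nonneg_right (Finset.sum_le_sum fun σ _ => ?_) zero_le_two
  simp only [hg, hg', hrest]
  have hb := hle (s σ) (s (flip σ))
  rw [hf0]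
  by_cases h : 0 ≤ sgn (σ i₀) * (g' (s σ) i₀ - g' (s (flip σ)) i₀)
  · have e1 : s' σ = s σ := if_pos h
    have e2 : s' (flip σ) = s (flip σ) := if_pos (by rw [hcond]; exact h)
    rw [e1, e2]
    rcases sgn_eq_or (σ i₀) with hs | hs <;> rw [hs] at h ⊢
    · rw [abs_of_nonneg (by linarith : 0 ≤ g' (s σ) i₀ - g' (s (flip σ)) i₀)] at hb
      linarith [abs_le.1 hb]
    · rw [abs_of_nonpos (by linarith : g' (s σ) i₀ - g' (s (flip σ)) i₀ ≤ 0)] at hb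
      linarith [abs_le.1 hb]
  · have e1 : s' σ = s (flip σ) := if_neg h
    have e2 : s' (flip σ) = s σ := by
      have : s' (flip σ) = s (flip (flip σ)) := if_neg (by rw [hcond]; exact h)
      rw [this, hinv σ]
    rw [e1, e2]
    rcases sgn_eq_or (σ i₀) with hs | hs <;> rw [hs] at h ⊢
    · rw [abs_of_nonpos (by linarith : g' (s σ) i₀ - g' (s (flip σ)) i₀ ≤ 0)] at hb
      linarith [abs_le.1 hb]
    · rw [abs_of_nonneg (by linarith : 0 ≤ g' (s σ) i₀ - g' (s (flip σ)) i₀)] at hb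
      linarith [abs_le.1 hb]

/-- The contraction principle for Rademacher averages, for selections instead of suprema. -/
lemma exists_selection_contraction {m : ℕ} {T : Type*} (φ : Fin m → ℝ → ℝ)
    (hφ : ∀ i p q, |φ i p - φ i q| ≤ |p - q|) (u : T → Fin m → ℝ) (s : (Fin m → Bool) → T) :
    ∃ s' : (Fin m → Bool) → T, signAvg (fun σ => ∑ i, sgn (σ i) * φ i (u (s σ) i)) ≤
      signAvg (fun σ => ∑ i, sgn (σ i) * u (s' σ) i) := by
  classical
  have key : ∀ A : Finset (Fin m), ∃ s' : (Fin m → Bool) → T,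
      ∑ σ, ∑ i, sgn (σ i) * φ i (u (s σ) i) ≤
      ∑ σ, ∑ i, sgn (σ i) * (if i ∈ A then u (s' σ) i else φ i (u (s' σ) i)) := by
    intro A
    induction A using Finset.induction_on with
    | empty => exact ⟨s, by simp⟩
    | insert i₀ A hi ih =>
      obtain ⟨s₁, h₁⟩ := ih
      obtain ⟨s₂, h₂⟩ := exists_selection_contraction_step i₀
        (fun t i => if i ∈ A then u t i else φ i (u t i))
        (fun t i => if i ∈ insert i₀ A then u t i else φ i (u t i))
        (fun t i h => by simp [h]) (fun t t' => by simpa [hi] using hφ i₀ _ _) s₁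
      exact ⟨s₂, h₁.trans h₂⟩
  obtain ⟨s', h⟩ := key Finset.univ
  refine ⟨s', ?_⟩
  exact div_le_div_of_nonneg_right (by simpa using h) (by positivity)

/-! ### Rademacher averages of the `ℓ1` ball and of finite unions -/

lemma signAvg_sgn_mul_sum {m : ℕ} (c : Fin m → ℝ) :
    signAvg (fun σ => ∑ i, sgn (σ i) * c i) = 0 := by
  have h := signAvg_comp_not (fun σ : Fin m → Bool => ∑ i, sgn (σ i) * c i)
  have h2 : (fun σ : Fin m → Bool => ∑ i, sgn (!σ i) * c i) =
      fun σ => (-1) * ∑ i, sgn (σ i) * c i := by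
    funext σ; rw [Finset.mul_sum]; simp [sgn_not]
  rw [h2, signAvg_const_mul] at h
  linarith

lemma sum_sgn_update_sub {m : ℕ} (c : Fin m → ℝ) (σ : Fin m → Bool) (i : Fin m) :
    (∑ j, sgn (Function.update σ i true j) * c j) - ∑ j, sgn (Function.update σ i false j) * c j
      = 2 * c i := by
  rw [← Finset.sum_sub_distrib, Finset.sum_eq_single i]
  · simp [sgn]; ring
  · intro j _ hj; simp [hj]
  · simp

/-- Rademacher averages of the `ℓ1` ball on points of the unit cube. -/
lemma signAvg_l1_le {m d : ℕ} (hd : 1 ≤ d) {B l : ℝ} (hB : 0 ≤ B) (hl : 0 < l)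
    (x : Fin m → Fin d → ℝ) (hx : ∀ i j, |x i j| ≤ 1) (w : (Fin m → Bool) → Fin d → ℝ)
    (hw : ∀ σ, ∑ j, |w σ j| ≤ B) :
    signAvg (fun σ => ∑ i, sgn (σ i) * ∑ j, w σ j * x i j) ≤
      B * ((Real.log (2 * d) + l ^ 2 * m / 2) / l) := by
  have : Nonempty (Fin d) := ⟨⟨0, hd⟩⟩
  -- The `2d` vertices of the `ℓ1` ball: a linear form is largest at one of them.
  let Z : Fin d × Bool → (Fin m → Bool) → ℝ := fun v σ => ∑ i, sgn (σ i) * (sgn v.2 * x i v.1)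
  have hsel : ∀ σ, ∃ v : Fin d × Bool, ∀ j, |∑ i, sgn (σ i) * x i j| ≤ Z v σ := by
    intro σ
    obtain ⟨j₀, -, hj₀⟩ := Finset.exists_max_image Finset.univ
      (fun j => |∑ i, sgn (σ i) * x i j|) Finset.univ_nonempty
    have hZ : ∀ b, Z (j₀, b) σ = sgn b * ∑ i, sgn (σ i) * x i j₀ := by
      intro b; simp only [Z]; rw [Finset.mul_sum]
      exact Finset.sum_congr rfl fun i _ => by ring
    rcases le_total 0 (∑ i, sgn (σ i) * x i j₀) with h | h
    · refine ⟨(j₀, true), fun j => (hj₀ j (Finset.mem_univ _)).trans ?_⟩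
      rw [hZ, abs_of_nonneg h, sgn, if_pos rfl, one_mul]
    · refine ⟨(j₀, false), fun j => (hj₀ j (Finset.mem_univ _)).trans ?_⟩
      rw [hZ, abs_of_nonpos h, sgn, if_neg (by simp), neg_one_mul]
  choose v hv using hsel
  have hmgf : ∀ v, signAvg (fun σ => Real.exp (l * Z v σ)) ≤ Real.exp (l ^ 2 * m / 2) := by
    intro v
    have := signAvg_exp_le l hl.le (Z v) (fun σ i => by
      simp only [Z, sum_sgn_update_sub]
      rw [abs_mul, abs_mul, abs_two]
      have h1 : |sgn v.2| = 1 := by rcases sgn_eq_or v.2 with h | h <;> simp [h]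
      rw [h1]; linarith [hx i v.1])
    rwa [show signAvg (Z v) = 0 from signAvg_sgn_mul_sum _, mul_zero, zero_add] at this
  have h1 := signAvg_selection_le Z hl hmgf v
  have hcard : (Fintype.card (Fin d × Bool) : ℝ) = 2 * d := by simp [mul_comm]
  rw [hcard] at h1
  refine le_trans ?_ (mul_le_mul_of_nonneg_left h1 hB)
  rw [← signAvg_const_mul]
  refine signAvg_mono fun σ => ?_
  have hZ0 : 0 ≤ Z (v σ) σ := (abs_nonneg _).trans (hv σ (Classical.arbitrary _))
  calc ∑ i, sgn (σ i) * ∑ j, w σ j * x i j = ∑ j, w σ j * ∑ i, sgn (σ i) * x i j := by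
        simp only [Finset.mul_sum]
        rw [Finset.sum_comm]
        exact Finset.sum_congr rfl fun i _ => Finset.sum_congr rfl fun j _ => by ring
    _ ≤ ∑ j, |w σ j| * Z (v σ) σ := by
        refine Finset.sum_le_sum fun j _ => (le_abs_self _).trans ?_
        rw [abs_mul]
        exact mul_le_mul_of_nonneg_left (hv σ j) (abs_nonneg _)
    _ ≤ B * Z (v σ) σ := by
        rw [← Finset.sum_mul]
        exact mul_le_mul_of_nonneg_right (hw σ) hZ0

/-- Rademacher averages of a union of finitely many classes indexed by `W` with values in `[0, 1]`,
each of which has small Rademacher averages. -/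
lemma signAvg_union_le {m : ℕ} {W T : Type*} [Fintype W] (f : W → T → Fin m → ℝ) {μ l : ℝ}
    (hl : 0 < l) (hf0 : ∀ v t i, 0 ≤ f v t i) (hf1 : ∀ v t i, f v t i ≤ 1)
    (hμ : ∀ v (s : (Fin m → Bool) → T), signAvg (fun σ => ∑ i, sgn (σ i) * f v (s σ) i) ≤ μ)
    (s : (Fin m → Bool) → T) (v : (Fin m → Bool) → W) :
    signAvg (fun σ => ∑ i, sgn (σ i) * f (v σ) (s σ) i) ≤
      μ + (Real.log (Fintype.card W) + l ^ 2 * m / 2) / l := by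
  -- A selection has finite range, so a maximum over that range replaces the supremum over `T`.
  have hmax : ∀ (w : W) (σ : Fin m → Bool), ∃ τ : Fin m → Bool, ∀ τ', ∑ i, sgn (σ i) * f w (s τ') i ≤
      ∑ i, sgn (σ i) * f w (s τ) i := by
    intro w σ
    obtain ⟨τ, -, h⟩ := Finset.exists_max_image Finset.univ
      (fun τ => ∑ i, sgn (σ i) * f w (s τ) i) Finset.univ_nonempty
    exact ⟨τ, fun τ' => h τ' (Finset.mem_univ _)⟩
  choose τ hτ using hmax
  let Z : W → (Fin m → Bool) → ℝ := fun w σ => ∑ i, sgn (σ i) * f w (s (τ w σ)) i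
  have hone : ∀ w σ i (b c : Bool), Z w (Function.update σ i b) ≤
      Z w (Function.update σ i c) + 2 := by
    intro w σ i b c
    set t := s (τ w (Function.update σ i b)) with ht
    have h1 : ∑ j, sgn (Function.update σ i c j) * f w t j ≤ Z w (Function.update σ i c) :=
      hτ w _ _
    have h2 := sum_sgn_update_sub (f w t) σ i
    have h3 : Z w (Function.update σ i b) = ∑ j, sgn (Function.update σ i b j) * f w t j := rfl
    have := hf0 w t i
    have := hf1 w t i
    cases b <;> cases c <;> linarith
  -- The maximizers form a selection themselves, so `hμ` bounds the mean of `Z w`; bounded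
  -- differences control the deviation from it.
  have hmgf : ∀ w, signAvg (fun σ => Real.exp (l * Z w σ)) ≤
      Real.exp (l * μ + l ^ 2 * m / 2) := by
    intro w
    refine (signAvg_exp_le l hl.le (Z w) fun σ i => ?_).trans ?_
    · rw [abs_le]; constructor <;> linarith [hone w σ i true false, hone w σ i false true]
    · gcongr
      exact hμ w fun σ => s (τ w σ)
  have h := signAvg_selection_le Z hl hmgf v
  calc _ ≤ signAvg (fun σ => Z (v σ) σ) := signAvg_mono fun σ => hτ (v σ) σ σ
    _ ≤ _ := h
    _ = _ := by field_simp; ring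

/-! ### Counting threshold patterns of sparse functionals -/

lemma sum_choose_le_pow (N D : ℕ) : ∑ i ∈ Finset.Iic D, N.choose i ≤ (N + 1) ^ D := by
  rw [add_pow, ← Nat.range_succ_eq_Iic]
  refine Finset.sum_le_sum fun i hi => ?_
  rw [one_pow, mul_one]
  calc N.choose i ≤ N ^ i := Nat.choose_le_pow N i
    _ ≤ _ := Nat.le_mul_of_pos_right _ (Nat.choose_pos (Finset.mem_range_succ_iff.1 hi))

open Classical in
/-- The subsets of a finite set of points of `ℝⁿ` cut out by linear functionals, where each point
comes with its own threshold. -/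
noncomputable def halfspaceTraces {α : Type*} [Fintype α] {n : ℕ} (p : α → Fin n → ℝ) (t : α → ℝ) :
    Finset (Finset α) :=
  Finset.univ.filter fun P => ∃ c : Fin n → ℝ, ∀ a, a ∈ P ↔ t a ≤ ∑ l, c l * p a l

/-- More than `n + 1` of the vectors `(p a, t a)` are linearly dependent. A functional cutting out
exactly the positive coefficients would make the weighted sum of `⟨c, p a⟩ - t a` positive, yet
dependence makes it zero. -/
lemma vcDim_halfspaceTraces_le {α : Type*} [Fintype α] [DecidableEq α] {n : ℕ}
    (p : α → Fin n → ℝ) (t : α → ℝ) : (halfspaceTraces p t).vcDim ≤ n + 1 := by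
  refine Finset.sup_le fun s hs => ?_
  rw [Finset.mem_shatterer] at hs
  by_contra! hcard
  have hdep : ¬ LinearIndependent ℝ (fun a : s => ((p a, t a) : (Fin n → ℝ) × ℝ)) := by
    intro h
    have := h.fintype_card_le_finrank
    simp at this
    omega
  rw [Fintype.not_linearIndependent_iff] at hdep
  -- A negative coefficient is wanted because only points outside the halfspace satisfy a strict
  -- inequality.
  have hneg : ∃ g : s → ℝ, ∑ a, g a • ((p a, t a) : (Fin n → ℝ) × ℝ) = 0 ∧ ∃ a, g a < 0 := by
    obtain ⟨g, hg, a, ha⟩ := hdep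
    rcases lt_or_gt_of_ne ha with h | h
    · exact ⟨g, hg, a, h⟩
    · exact ⟨-g, by simp only [Pi.neg_apply, neg_smul, Finset.sum_neg_distrib, hg, neg_zero], a,
        by simpa using h⟩
  obtain ⟨g, hg, a₀, ha₀⟩ := hneg
  obtain ⟨u, hu, hsu⟩ := hs (t := (Finset.univ.filter fun a : s => 0 < g a).map
    (Function.Embedding.subtype _)) (by
      intro a ha
      simp only [Finset.mem_map, Function.Embedding.subtype_apply] at ha
      obtain ⟨b, -, rfl⟩ := ha
      exact b.2)
  obtain ⟨c, hc⟩ : ∃ c : Fin n → ℝ, ∀ a, a ∈ u ↔ t a ≤ ∑ l, c l * p a l := by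
    simpa [halfspaceTraces] using hu
  have hiff : ∀ a : s, t a ≤ ∑ l, c l * p a l ↔ 0 < g a := by
    intro a
    rw [← hc]
    have : (a : α) ∈ s ∩ u ↔ 0 < g a := by rw [hsu]; simp
    rw [← this]; simp
  have h1 : ∀ l, ∑ a, g a * p a l = 0 := by
    intro l
    have := congrFun (congrArg Prod.fst hg) l
    simpa [Prod.fst_sum, Finset.sum_apply] using this
  have h2 : ∑ a, g a * t a = 0 := by
    have := congrArg Prod.snd hg
    simpa [Prod.snd_sum] using this
  have h3 : ∑ a, g a * (∑ l, c l * p a l - t a) = 0 := by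
    simp only [mul_sub, Finset.sum_sub_distrib, h2, sub_zero, Finset.mul_sum]
    rw [Finset.sum_comm]
    refine Finset.sum_eq_zero fun l _ => ?_
    have : ∑ a, g a * (c l * p a l) = c l * ∑ a, g a * p a l := by
      rw [Finset.mul_sum]; exact Finset.sum_congr rfl fun a _ => by ring
    rw [this, h1, mul_zero]
  have h4 : 0 < ∑ a, g a * (∑ l, c l * p a l - t a) := by
    refine Finset.sum_pos' (fun a _ => ?_) ⟨a₀, Finset.mem_univ _, ?_⟩
    · by_cases h : 0 < g a
      · exact mul_nonneg h.le (sub_nonneg.2 ((hiff a).2 h))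
      · have := mt (hiff a).1 h
        exact mul_nonneg_of_nonpos_of_nonpos (not_lt.1 h) (by linarith)
    · have := mt (hiff a₀).1 (not_lt.2 ha₀.le)
      exact mul_pos_of_neg_of_neg ha₀ (by linarith)
  exact h4.ne' h3

lemma card_halfspaceTraces_le {α : Type*} [Fintype α] {n : ℕ} (p : α → Fin n → ℝ) (t : α → ℝ) :
    (halfspaceTraces p t).card ≤ (Fintype.card α + 1) ^ (n + 1) := by
  classical
  calc _ ≤ _ := Finset.card_le_card_shatterer _
    _ ≤ _ := Finset.card_shatterer_le_sum_vcDim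
    _ ≤ _ := sum_choose_le_pow _ _
    _ ≤ _ := Nat.pow_le_pow_right (Nat.succ_pos _) (vcDim_halfspaceTraces_le p t)

/-- A `k`-sparse linear functional is a linear functional of `k` chosen coordinates. -/
lemma exists_coordinates_of_sparse {d k : ℕ} (hd : 1 ≤ d) (w : Fin d → ℝ)
    (hw : {j | w j ≠ 0}.ncard ≤ k) : ∃ (f : Fin k → Fin d) (c : Fin k → ℝ),
    ∀ x : Fin d → ℝ, ∑ j, w j * x j = ∑ l, c l * x (f l) := by
  classical
  have hcard : Fintype.card {j // w j ≠ 0} ≤ Fintype.card (Fin k) := by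
    rw [Fintype.card_fin, ← Nat.card_eq_fintype_card]
    exact hw
  obtain ⟨e⟩ := Function.Embedding.nonempty_of_card_le hcard
  -- Slots outside the range of `e` get coefficient zero, so their default coordinate does not
  -- matter.
  refine ⟨Function.extend e Subtype.val (fun _ => ⟨0, hd⟩),
    Function.extend e (fun j => w j) 0, fun x => ?_⟩
  rw [← Fintype.sum_of_injective e e.injective (fun j : {j // w j ≠ 0} => w j * x j)]
  · refine (Fintype.sum_of_injective Subtype.val Subtype.val_injective _ _ ?_ fun _ => rfl).symm
    intro j hj
    have : w j = 0 := by
      by_contra h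
      exact hj ⟨⟨j, h⟩, rfl⟩
    simp [this]
  · intro l hl
    rw [Function.extend_apply' _ _ _ hl]; simp
  · intro j
    rw [e.injective.extend_apply, e.injective.extend_apply]

/-- Finitely many value vectors represent all threshold patterns of `k`-sparse functionals. -/
lemma exists_threshold_cover {d m N : ℕ} (k : ℕ) (hd : 1 ≤ d) (x : Fin m → Fin d → ℝ)
    (t : Fin N → ℝ) : ∃ W : Finset (Fin m → ℝ), W.card ≤ (d * (m * N + 1) ^ 2) ^ k ∧
      ∀ w : Fin d → ℝ, {j | w j ≠ 0}.ncard ≤ k → ∃ v ∈ W, ∀ i l,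
        t l ≤ ∑ j, w j * x i j ↔ t l ≤ v i := by
  classical
  rcases Nat.eq_zero_or_pos k with rfl | hk
  -- The general count has exponent `k + 1`, which is at most `2 * k` only for positive `k`.
  · refine ⟨{0}, by simp, fun w hw => ⟨0, by simp, fun i l => ?_⟩⟩
    have hw0 : ∀ j, w j = 0 := by
      have h := (Set.ncard_eq_zero (Set.toFinite _)).1 (Nat.le_zero.1 hw)
      intro j
      by_contra hj
      exact (Set.eq_empty_iff_forall_notMem.1 h j) hj
    simp [hw0]
  -- The points to be cut are pairs of a sample index and a grid index, each with its own threshold.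
  · let p : (Fin k → Fin d) → Fin m × Fin N → Fin k → ℝ := fun f a l => x a.1 (f l)
    let F : (Fin k → Fin d) → Finset (Finset (Fin m × Fin N)) := fun f =>
      halfspaceTraces (p f) (fun a => t a.2)
    have hrep : ∀ f P, ∃ c : Fin k → ℝ, P ∈ F f → ∀ a, a ∈ P ↔ t a.2 ≤ ∑ l, c l * p f a l := by
      intro f P
      by_cases hP : P ∈ F f
      · obtain ⟨c, hc⟩ : ∃ c : Fin k → ℝ, ∀ a, a ∈ P ↔ t a.2 ≤ ∑ l, c l * p f a l := by
          simpa [F, halfspaceTraces] using hP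
        exact ⟨c, fun _ => hc⟩
      · exact ⟨0, fun h => absurd h hP⟩
    choose c hc using hrep
    refine ⟨Finset.univ.biUnion fun f => (F f).image fun P i => ∑ l, c f P l * x i (f l), ?_, ?_⟩
    · refine (Finset.card_biUnion_le_card_mul _ _ ((m * N + 1) ^ (k + 1)) fun f _ =>
        Finset.card_image_le.trans ?_).trans ?_
      · simpa using card_halfspaceTraces_le (p f) (fun a => t a.2)
      · rw [mul_pow, ← pow_mul]
        simp only [Finset.card_univ, Fintype.card_fun, Fintype.card_fin]
        gcongr
        · omega
        · omega
    · intro w hw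
      obtain ⟨f, c', hc'⟩ := exists_coordinates_of_sparse hd w hw
      let P : Finset (Fin m × Fin N) := Finset.univ.filter fun a => t a.2 ≤ ∑ l, c' l * p f a l
      have hP : P ∈ F f := by
        simp only [F, halfspaceTraces, Finset.mem_filter, Finset.mem_univ, true_and]
        exact ⟨c', fun a => by simp [P]⟩
      refine ⟨fun i => ∑ l, c f P l * x i (f l), ?_, fun i l => ?_⟩
      · exact Finset.mem_biUnion.2 ⟨f, Finset.mem_univ _, Finset.mem_image_of_mem _ hP⟩
      · have h1 := hc f P hP (i, l)
        have h2 : (i, l) ∈ P ↔ t l ≤ ∑ l', c' l' * p f (i, l) l' := by simp [P]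
        rw [hc']
        exact h2.symm.trans h1

/-! ### The ramp loss and its discretization -/

lemma clip_nonneg (r : ℝ) : 0 ≤ clip r := le_max_left _ _

lemma clip_le_one (r : ℝ) : clip r ≤ 1 := max_le zero_le_one (min_le_right _ _)

lemma abs_clip_sub_le (p q : ℝ) : |clip p - clip q| ≤ |p - q| := by
  unfold clip
  rw [max_comm 0, max_comm 0]
  refine (abs_max_sub_max_le_abs _ _ _).trans ((abs_min_sub_min_le_max _ _ _ _).trans ?_)
  simp

lemma abs_label (y : Label) : |(y : ℝ)| = 1 := by
  rcases y.2 with h | h <;> simp [h]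

lemma abs_rampLoss_sub_le (p q : ℝ) (y : Label) : |rampLoss p y - rampLoss q y| ≤ |p - q| := by
  refine (abs_clip_sub_le _ _).trans_eq ?_
  rw [show 1 - p * (y : ℝ) - (1 - q * y) = (q - p) * y by ring, abs_mul, abs_label, mul_one,
    abs_sub_comm]

lemma clip_of_nonpos {r : ℝ} (h : r ≤ 0) : clip r = 0 := by
  unfold clip; rw [min_eq_left (by linarith), max_eq_left h]

lemma clip_of_one_le {r : ℝ} (h : 1 ≤ r) : clip r = 1 := by
  unfold clip; rw [min_eq_right h, max_eq_right zero_le_one]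

lemma rampLoss_const_of_ge {B a b b' : ℝ} (ha : |a| ≤ B) (hb : B + 1 ≤ b) (hb' : B + 1 ≤ b')
    (y : Label) : rampLoss (a + b) y = rampLoss (a + b') y := by
  have := abs_le.1 ha
  unfold rampLoss
  rcases y.2 with h | h <;> rw [h]
  · rw [clip_of_nonpos (by linarith), clip_of_nonpos (by linarith)]
  · rw [clip_of_one_le (by linarith), clip_of_one_le (by linarith)]

lemma rampLoss_const_of_le {B a b b' : ℝ} (ha : |a| ≤ B) (hb : b ≤ -(B + 1)) (hb' : b' ≤ -(B + 1))
    (y : Label) : rampLoss (a + b) y = rampLoss (a + b') y := by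
  have := abs_le.1 ha
  unfold rampLoss
  rcases y.2 with h | h <;> rw [h]
  · rw [clip_of_one_le (by linarith), clip_of_one_le (by linarith)]
  · rw [clip_of_nonpos (by linarith), clip_of_nonpos (by linarith)]

/-- Offsets with the same position relative to a fine grid give nearly the same ramp loss. -/
lemma abs_rampLoss_sub_le_of_grid {B η a b b' : ℝ} (hη : 0 < η) {M : ℕ}
    (hM : 2 * (B + 1) ≤ M * η) (ha : |a| ≤ B)
    (h : ∀ l : Fin (M + 1), -(B + 1) + l * η ≤ b ↔ -(B + 1) + l * η ≤ b') (y : Label) :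
    |rampLoss (a + b) y - rampLoss (a + b') y| ≤ η := by
  wlog hbb : b ≤ b' generalizing b b'
  · rw [abs_sub_comm]
    exact this (fun l => (h l).symm) (le_of_not_ge hbb)
  by_cases h1 : b' - b ≤ η
  · refine (abs_rampLoss_sub_le _ _ y).trans ?_
    rw [abs_le]; constructor <;> linarith
  push Not at h1
  by_cases h2 : B + 1 ≤ b
  · rw [rampLoss_const_of_ge ha h2 (h2.trans hbb), sub_self, abs_zero]; exact hη.le
  by_cases h3 : b' ≤ -(B + 1)
  · rw [rampLoss_const_of_le ha (hbb.trans h3) h3, sub_self, abs_zero]; exact hη.le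
  push Not at h2 h3
  exfalso
  by_cases h4 : b < -(B + 1)
  · have := (h 0).2 (by simpa using h3.le)
    simp at this
    linarith
  push Not at h4
  set n := ⌊(b + (B + 1)) / η⌋₊ with hn
  have h0 : 0 ≤ (b + (B + 1)) / η := div_nonneg (by linarith) hη.le
  have hn1 : (n : ℝ) * η ≤ b + (B + 1) := by
    have := Nat.floor_le h0
    rwa [le_div_iff₀ hη] at this
  have hn2 : b + (B + 1) < (n + 1) * η := by
    have := Nat.lt_floor_add_one ((b + (B + 1)) / η)
    rwa [div_lt_iff₀ hη] at this
  have hnM : n < M := by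
    have : (n : ℝ) * η < M * η := by linarith
    exact_mod_cast lt_of_mul_lt_mul_right this hη.le
  -- Grid point `n + 1` is the first above `b`; as `b' - b > η`, it is at most `b'` and separates
  -- the two.
  have := (h ⟨n + 1, by omega⟩).2 (by push_cast; linarith)
  push_cast at this
  linarith

lemma rampLoss_nonneg (p y : ℝ) : 0 ≤ rampLoss p y := clip_nonneg _

lemma rampLoss_le_one (p y : ℝ) : rampLoss p y ≤ 1 := clip_le_one _

/-! ### Rademacher complexity of the class -/

/-- Rademacher averages of the ramp losses of `H10`. -/
lemma signAvg_rampLoss_le {d m k M : ℕ} (hd : 1 ≤ d) {B τ : ℝ} (hB : 0 ≤ B) (hτ : 0 < τ)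
    (hM : 2 * (B + 1) ≤ M * τ) (ha : B ^ 2 * Real.log (2 * d) ≤ m * τ ^ 2 / 2)
    (hb : k * Real.log (d * (m * (M + 1) + 1) ^ 2) ≤ m * τ ^ 2 / 2)
    (z : Fin m → Cube d × Label) (h : (Fin m → Bool) → Cube d → ℝ) (hh : ∀ σ, h σ ∈ H10 d k B) :
    signAvg (fun σ => ∑ i, sgn (σ i) * rampLoss (h σ (z i).1) (z i).2) ≤ 3 * (m * τ) := by
  choose wa wb hwa hwb heq using hh
  let x : Fin m → Fin d → ℝ := fun i => (z i).1.1
  have hx : ∀ i j, |x i j| ≤ 1 := fun i => (z i).1.2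
  obtain ⟨W, hWcard, hW⟩ := exists_threshold_cover k hd x
    (fun l : Fin (M + 1) => -(B + 1) + l * τ)
  choose v hvW hv using fun σ => hW (wb σ) (hwb σ)
  let T := {w : Fin d → ℝ // ∑ j, |w j| ≤ B}
  let s : (Fin m → Bool) → T := fun σ => ⟨wa σ, hwa σ⟩
  let u : T → Fin m → ℝ := fun t i => ∑ j, t.1 j * x i j
  have hu : ∀ t i, |u t i| ≤ B := fun t i =>
    (Finset.abs_sum_le_sum_abs _ _).trans ((Finset.sum_le_sum fun j _ => by
      rw [abs_mul]
      exact mul_le_of_le_one_right (abs_nonneg _) (hx i j)).trans t.2)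
  let f : W → T → Fin m → ℝ := fun v t i => rampLoss (u t i + v.1 i) (z i).2
  have hlin : ∀ s' : (Fin m → Bool) → T,
      signAvg (fun σ => ∑ i, sgn (σ i) * u (s' σ) i) ≤ m * τ := by
    intro s'
    rcases hB.eq_or_lt with rfl | hB'
    · have := signAvg_l1_le hd le_rfl one_pos x hx (fun σ => (s' σ).1) (fun σ => (s' σ).2)
      refine this.trans ?_
      rw [zero_mul]; positivity
    -- The exponent `τ / B` makes each of the two resulting terms at most `m * τ / 2`.
    · refine (signAvg_l1_le hd hB (div_pos hτ hB') x hx (fun σ => (s' σ).1)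
        (fun σ => (s' σ).2)).trans ?_
      have e : B * ((Real.log (2 * d) + (τ / B) ^ 2 * m / 2) / (τ / B)) =
          (B ^ 2 * Real.log (2 * d)) / τ + m * τ / 2 := by field_simp
      rw [e]
      have : (B ^ 2 * Real.log (2 * d)) / τ ≤ m * τ / 2 := by
        rw [div_le_iff₀ hτ]; linarith
      linarith
  have hμ : ∀ v (s : (Fin m → Bool) → T),
      signAvg (fun σ => ∑ i, sgn (σ i) * f v (s σ) i) ≤ m * τ := by
    intro v s
    obtain ⟨s', hs'⟩ := exists_selection_contraction
      (fun i p => rampLoss (p + v.1 i) (z i).2)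
      (fun i p q => (abs_rampLoss_sub_le _ _ _).trans_eq (by congr 1; ring)) u s
    exact hs'.trans (hlin s')
  have hunion := signAvg_union_le f hτ (fun _ _ _ => rampLoss_nonneg _ _)
    (fun _ _ _ => rampLoss_le_one _ _) hμ s (fun σ => ⟨v σ, hvW σ⟩)
  have hlog : Real.log (Fintype.card W) ≤ m * τ ^ 2 / 2 := by
    refine le_trans ?_ hb
    rw [← Real.log_pow]
    have : 0 < W.card := Finset.card_pos.2 ⟨_, hvW (fun _ => true)⟩
    refine Real.log_le_log (by simpa using this) ?_
    rw [Fintype.card_coe]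
    exact_mod_cast hWcard
  have hsecond : (Real.log (Fintype.card W) + τ ^ 2 * m / 2) / τ ≤ m * τ := by
    rw [div_le_iff₀ hτ]; linarith
  have hround : ∀ σ i, sgn (σ i) * rampLoss (h σ (z i).1) (z i).2 ≤
      sgn (σ i) * f ⟨v σ, hvW σ⟩ (s σ) i + τ := by
    intro σ i
    have h1 : h σ (z i).1 = u (s σ) i + ∑ j, wb σ j * x i j := by
      rw [heq]
      simp only [add_mul, Finset.sum_add_distrib]
      rfl
    have h2 := abs_le.1 (abs_rampLoss_sub_le_of_grid hτ hM (hu (s σ) i) (hv σ i) (z i).2)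
    rw [h1]
    simp only [f]
    rcases sgn_eq_or (σ i) with hs | hs <;> rw [hs] <;> linarith
  -- One `m * τ` each for rounding the offsets, for the `ℓ1` part and for the union.
  calc _ ≤ signAvg (fun σ => (∑ i, sgn (σ i) * f ⟨v σ, hvW σ⟩ (s σ) i) + m * τ) := by
        refine signAvg_mono fun σ => (Finset.sum_le_sum fun i _ => hround σ i).trans_eq ?_
        rw [Finset.sum_add_distrib]; simp
    _ = _ := by rw [signAvg_add _ (fun _ => _), signAvg_const]
    _ ≤ _ := by linarith

/-! ### Symmetrization -/

lemma integrable_of_unit {Ω : Type*} [MeasurableSpace Ω] {μ : Measure Ω} [IsProbabilityMeasure μ]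
    {f : Ω → ℝ} (hf : Measurable f) (h0 : ∀ x, 0 ≤ f x) (h1 : ∀ x, f x ≤ 1) : Integrable f μ :=
  Integrable.of_mem_Icc 0 1 hf.aemeasurable (Filter.Eventually.of_forall fun x => ⟨h0 x, h1 x⟩)

/-- Exchange the coordinates at which `σ` is `false`. -/
def swapAt {m : ℕ} {Z : Type*} (σ : Fin m → Bool) (p : (Fin m → Z) × (Fin m → Z)) :
    (Fin m → Z) × (Fin m → Z) :=
  (fun i => if σ i then p.1 i else p.2 i, fun i => if σ i then p.2 i else p.1 i)

lemma measurePreserving_swapAt {m : ℕ} {Z : Type*} [MeasurableSpace Z] (D : Measure Z)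
    [IsProbabilityMeasure D] (σ : Fin m → Bool) :
    MeasurePreserving (swapAt σ) ((Measure.pi fun _ : Fin m => D).prod (Measure.pi fun _ => D))
      ((Measure.pi fun _ : Fin m => D).prod (Measure.pi fun _ => D)) := by
  have he := measurePreserving_arrowProdEquivProdArrow Z Z (Fin m) (fun _ => D) (fun _ => D)
  have hs : MeasurePreserving (fun (p : Fin m → Z × Z) i => (if σ i then id else Prod.swap) (p i))
      (Measure.pi fun _ => D.prod D) (Measure.pi fun _ => D.prod D) := by
    refine measurePreserving_pi (f := fun i => if σ i then id else Prod.swap) _ _ fun i => ?_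
    by_cases h : σ i
    · simpa [h] using MeasurePreserving.id _
    · simpa [h] using Measure.measurePreserving_swap
  convert he.comp (hs.comp he.symm) using 1
  funext p
  refine Prod.ext (funext fun i => ?_) (funext fun i => ?_) <;> by_cases h : σ i <;>
    simp [swapAt, h, MeasurableEquiv.arrowProdEquivProdArrow, Equiv.arrowProdEquivProdArrow]

/-- Symmetrization with a ghost sample: the generalization gap of a sample-dependent loss is
bounded by its Rademacher averages. -/
lemma generalization_gap_le {m : ℕ} {Z : Type*} [MeasurableSpace Z] (D : Measure Z)
    [IsProbabilityMeasure D] (G : (Fin m → Z) → Z → ℝ)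
    (hG : Measurable fun p : (Fin m → Z) × Z => G p.1 p.2) (h0 : ∀ S z, 0 ≤ G S z)
    (h1 : ∀ S z, G S z ≤ 1) {r : ℝ}
    (hr : ∀ (z : Fin m → Z) (s : (Fin m → Bool) → Fin m → Z),
      signAvg (fun σ => ∑ i, sgn (σ i) * G (s σ) (z i)) ≤ r) :
    m * ∫ S, ∫ z, G S z ∂D ∂(Measure.pi fun _ : Fin m => D) ≤
      ∫ S, ∑ i, G S (S i) ∂(Measure.pi fun _ : Fin m => D) + 2 * r := by
  set μ := Measure.pi fun _ : Fin m => D with hμ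
  let Q := μ.prod μ
  let Φ : (Fin m → Z) × (Fin m → Z) → ℝ := fun p => ∑ i, (G p.1 (p.2 i) - G p.1 (p.1 i))
  have m1 : ∀ i, Measurable fun p : (Fin m → Z) × (Fin m → Z) => G p.1 (p.2 i) := fun i =>
    hG.comp (measurable_fst.prodMk ((measurable_pi_apply i).comp measurable_snd))
  have m2 : ∀ i, Measurable fun S : Fin m → Z => G S (S i) := fun i =>
    hG.comp (measurable_id.prodMk (measurable_pi_apply i))
  have m3 : ∀ i, Measurable fun p : (Fin m → Z) × (Fin m → Z) => G p.1 (p.1 i) := fun i =>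
    (m2 i).comp measurable_fst
  have i1 : ∀ i, Integrable (fun p : (Fin m → Z) × (Fin m → Z) => G p.1 (p.2 i)) Q := fun i =>
    integrable_of_unit (m1 i) (fun _ => h0 _ _) (fun _ => h1 _ _)
  have i2 : ∀ i, Integrable (fun S : Fin m → Z => G S (S i)) μ := fun i =>
    integrable_of_unit (m2 i) (fun _ => h0 _ _) (fun _ => h1 _ _)
  have i3 : ∀ i, Integrable (fun p : (Fin m → Z) × (Fin m → Z) => G p.1 (p.1 i)) Q := fun i =>
    integrable_of_unit (m3 i) (fun _ => h0 _ _) (fun _ => h1 _ _)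
  have hΦm : Measurable Φ := Finset.measurable_sum _ fun i _ => (m1 i).sub (m3 i)
  have hΦi : Integrable Φ Q := integrable_finsetSum _ fun i _ => (i1 i).sub (i3 i)
  have hΦ : ∫ p, Φ p ∂Q = m * ∫ S, ∫ z, G S z ∂D ∂μ - ∫ S, ∑ i, G S (S i) ∂μ := by
    have e1 : ∀ i, ∫ p : (Fin m → Z) × (Fin m → Z), G p.1 (p.2 i) ∂Q =
        ∫ S, ∫ z, G S z ∂D ∂μ := by
      intro i
      rw [integral_prod _ (i1 i)]
      congr 1; funext S
      have hmp := measurePreserving_eval (fun _ : Fin m => D) i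
      have hGS : Measurable (G S) := hG.comp (measurable_const.prodMk measurable_id)
      rw [← hmp.map_eq, integral_map hmp.measurable.aemeasurable
        hGS.aestronglyMeasurable]
    have e2 : ∀ i, ∫ p : (Fin m → Z) × (Fin m → Z), G p.1 (p.1 i) ∂Q = ∫ S, G S (S i) ∂μ := by
      intro i
      rw [integral_prod _ (i3 i)]
      simp
    simp only [Φ]
    rw [integral_finsetSum (f := fun i (p : (Fin m → Z) × (Fin m → Z)) =>
        G p.1 (p.2 i) - G p.1 (p.1 i)) _ fun i _ => (i1 i).sub (i3 i),
      integral_finsetSum _ fun i _ => i2 i]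
    simp only [integral_sub (i1 _) (i3 _), e1, e2]
    simp
  have hswap : ∀ σ, ∫ p, Φ (swapAt σ p) ∂Q = ∫ p, Φ p ∂Q := by
    intro σ
    have hmp := measurePreserving_swapAt D σ
    conv_rhs => rw [show Q = Q.map (swapAt σ) from hmp.map_eq.symm]
    rw [integral_map hmp.measurable.aemeasurable hΦm.aestronglyMeasurable]
  have hswapi : ∀ σ, Integrable (fun p => Φ (swapAt σ p)) Q := fun σ =>
    (measurePreserving_swapAt D σ).integrable_comp_of_integrable hΦi
  have hpt : ∀ p, signAvg (fun σ => Φ (swapAt σ p)) ≤ 2 * r := by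
    intro p
    have e : ∀ σ, Φ (swapAt σ p) = ∑ i, sgn (σ i) * G (swapAt σ p).1 (p.2 i) +
        ∑ i, sgn (!σ i) * G (swapAt σ p).1 (p.1 i) := by
      intro σ
      rw [← Finset.sum_add_distrib]
      refine Finset.sum_congr rfl fun i _ => ?_
      by_cases h : σ i <;> simp [swapAt, h, sgn] <;> ring
    simp only [e]
    rw [signAvg_add]
    -- The predictor is trained on the swapped sample and so varies with `σ`, while the evaluation
    -- points stay fixed.
    have b1 := hr p.2 fun σ => (swapAt σ p).1
    have b2 := hr p.1 fun σ => (swapAt (fun i => !σ i) p).1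
    rw [← signAvg_comp_not] at b2
    simp only [Bool.not_not] at b2
    linarith
  have hfin : ∫ p, Φ p ∂Q ≤ 2 * r := by
    calc ∫ p, Φ p ∂Q = signAvg (fun σ : Fin m → Bool => ∫ p, Φ (swapAt σ p) ∂Q) := by
          simp only [hswap, signAvg_const]
      _ = ∫ p, signAvg (fun σ => Φ (swapAt σ p)) ∂Q := by
          unfold signAvg
          rw [integral_div, integral_finsetSum _ fun σ _ => hswapi σ]
      _ ≤ ∫ p, 2 * r ∂Q := by
          refine integral_mono ?_ (integrable_const _) hpt
          exact (integrable_finsetSum _ fun σ _ => hswapi σ).div_const _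
      _ = 2 * r := by simp
  linarith

/-! ### Approximate empirical risk minimization -/

section ERM

variable {X : Type}

/-- The sum of the ramp losses of `g` over a sample. -/
noncomputable def empLoss (g : X → ℝ) {m : ℕ} (S : Fin m → X × Label) : ℝ :=
  ∑ i, rampLoss (g (S i).1) (S i).2

lemma empLoss_nonneg (g : X → ℝ) {m : ℕ} (S : Fin m → X × Label) : 0 ≤ empLoss g S :=
  Finset.sum_nonneg fun _ _ => rampLoss_nonneg _ _

lemma exists_near_minimizer (h : ℕ → X → ℝ) {τ : ℝ} (hτ : 0 < τ) {m : ℕ} (S : Fin m → X × Label) :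
    ∃ n, ∀ j, empLoss (h n) S ≤ empLoss (h j) S + τ := by
  have hb : BddBelow (Set.range fun n => empLoss (h n) S) :=
    ⟨0, by rintro _ ⟨n, rfl⟩; exact empLoss_nonneg _ _⟩
  obtain ⟨n, hn⟩ := exists_lt_of_ciInf_lt
    (lt_add_of_pos_right (⨅ n, empLoss (h n) S) hτ)
  exact ⟨n, fun j => by linarith [ciInf_le hb j]⟩

open Classical in
/-- The first index of a nearly minimal empirical loss. -/
noncomputable def nearMinimizer (h : ℕ → X → ℝ) {τ : ℝ} (hτ : 0 < τ) {m : ℕ}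
    (S : Fin m → X × Label) : ℕ := Nat.find (exists_near_minimizer h hτ S)

lemma nearMinimizer_spec (h : ℕ → X → ℝ) {τ : ℝ} (hτ : 0 < τ) {m : ℕ} (S : Fin m → X × Label)
    (j : ℕ) : empLoss (h (nearMinimizer h hτ S)) S ≤ empLoss (h j) S + τ := by
  classical
  exact Nat.find_spec (exists_near_minimizer h hτ S) j

variable [MeasurableSpace X]

lemma measurable_rampLoss : Measurable fun p : ℝ × ℝ => rampLoss p.1 p.2 := by
  unfold rampLoss clip
  fun_prop

lemma measurable_loss {g : X → ℝ} (hg : Measurable g) :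
    Measurable fun z : X × Label => rampLoss (g z.1) z.2 :=
  measurable_rampLoss.comp
    ((hg.comp measurable_fst).prodMk (measurable_subtype_coe.comp measurable_snd))

lemma measurable_empLoss {g : X → ℝ} (hg : Measurable g) (m : ℕ) :
    Measurable fun S : Fin m → X × Label => empLoss g S :=
  Finset.measurable_sum _ fun i _ => (measurable_loss hg).comp (measurable_pi_apply i)

/-- Taking the first admissible index gives measurability: each admissibility condition is a
countable intersection of comparisons between measurable losses. -/
lemma measurable_nearMinimizer {h : ℕ → X → ℝ} (hm : ∀ n, Measurable (h n)) {τ : ℝ} (hτ : 0 < τ)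
    (m : ℕ) : Measurable fun S : Fin m → X × Label => nearMinimizer h hτ S := by
  classical
  unfold nearMinimizer
  refine measurable_find _ fun n => ?_
  simp only [Set.ofPred_forall]
  exact MeasurableSet.iInter fun j => measurableSet_le (measurable_empLoss (hm n) m)
    ((measurable_empLoss (hm j) m).add_const τ)

lemma measurable_eval_nearMinimizer {h : ℕ → X → ℝ} (hm : ∀ n, Measurable (h n)) {τ : ℝ}
    (hτ : 0 < τ) {m : ℕ} {Ω : Type*} [MeasurableSpace Ω] {S : Ω → Fin m → X × Label} {x : Ω → X}
    (hS : Measurable S) (hx : Measurable x) :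
    Measurable fun ω => h (nearMinimizer h hτ (S ω)) (x ω) := by
  have h1 : Measurable fun q : ℕ × X => h q.1 q.2 := measurable_from_prod_countable_right hm
  have h2 : Measurable fun ω => nearMinimizer h hτ (S ω) := (measurable_nearMinimizer hm hτ m).comp hS
  exact h1.comp (h2.prodMk hx)

/-- Approximate empirical risk minimization over a sequence of predictors. -/
noncomputable def erm (h : ℕ → X → ℝ) (hm : ∀ n, Measurable (h n)) {τ : ℝ} (hτ : 0 < τ) :
    Algorithm X where
  Seed := Unit
  seedLaw := Measure.dirac ()
  output _ S _ := h (nearMinimizer h hτ S)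
  measurable_output _ := measurable_eval_nearMinimizer hm hτ
    (measurable_fst.comp measurable_fst) measurable_snd

lemma expLoss_nonneg (g : X → ℝ) (D : Measure (X × Label)) : 0 ≤ expLoss g D :=
  integral_nonneg fun _ => rampLoss_nonneg _ _

lemma bddBelow_expLoss (H : Set (X → ℝ)) (D : Measure (X × Label)) :
    BddBelow (Set.range fun g : H => expLoss (g : X → ℝ) D) :=
  ⟨0, by rintro _ ⟨g, rfl⟩; exact expLoss_nonneg _ _⟩

lemma expLoss_le_one {g : X → ℝ} (hg : Measurable g) (D : Measure (X × Label))
    [IsProbabilityMeasure D] : expLoss g D ≤ 1 := by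
  have h := integral_mono (μ := D) (integrable_of_unit (measurable_loss hg)
    (fun _ => rampLoss_nonneg _ _) (fun _ => rampLoss_le_one _ _)) (integrable_const (1 : ℝ))
    (fun _ => rampLoss_le_one _ _)
  simpa [expLoss] using h

lemma integrable_loss_eval {g : X → ℝ} (hg : Measurable g) (D : Measure (X × Label))
    [IsProbabilityMeasure D] {m : ℕ} (i : Fin m) :
    Integrable (fun S : Fin m → X × Label => rampLoss (g (S i).1) (S i).2)
      (Measure.pi fun _ : Fin m => D) :=
  integrable_of_unit ((measurable_loss hg).comp (measurable_pi_apply i))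
    (fun _ => rampLoss_nonneg _ _) (fun _ => rampLoss_le_one _ _)

lemma integrable_empLoss {g : X → ℝ} (hg : Measurable g) (D : Measure (X × Label))
    [IsProbabilityMeasure D] (m : ℕ) :
    Integrable (fun S : Fin m → X × Label => empLoss g S) (Measure.pi fun _ : Fin m => D) :=
  integrable_finsetSum _ fun i _ => integrable_loss_eval hg D i

lemma integral_empLoss {g : X → ℝ} (hg : Measurable g) (D : Measure (X × Label))
    [IsProbabilityMeasure D] (m : ℕ) :
    ∫ S : Fin m → X × Label, empLoss g S ∂(Measure.pi fun _ : Fin m => D) = m * expLoss g D := by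
  unfold empLoss
  rw [integral_finsetSum _ fun i _ => integrable_loss_eval hg D i]
  have : ∀ i, ∫ S : Fin m → X × Label, rampLoss (g (S i).1) (S i).2
      ∂(Measure.pi fun _ : Fin m => D) = expLoss g D := by
    intro i
    have hmp := measurePreserving_eval (fun _ : Fin m => D) i
    unfold expLoss
    conv_rhs => rw [← hmp.map_eq]
    rw [integral_map hmp.measurable.aemeasurable (measurable_loss hg).aestronglyMeasurable]
  simp [this]

lemma expLoss_le_add {g g' : X → ℝ} (hg : Measurable g) (hg' : Measurable g') {η : ℝ}
    (h : ∀ x, |g x - g' x| ≤ η) (D : Measure (X × Label)) [IsProbabilityMeasure D] :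
    expLoss g D ≤ expLoss g' D + η := by
  have hi : ∀ {f : X → ℝ}, Measurable f → Integrable (fun z : X × Label => rampLoss (f z.1) z.2) D :=
    fun hf => integrable_of_unit (measurable_loss hf) (fun _ => rampLoss_nonneg _ _)
      (fun _ => rampLoss_le_one _ _)
  calc expLoss g D ≤ ∫ z, (rampLoss (g' z.1) z.2 + η) ∂D := by
        refine integral_mono (hi hg) ((hi hg').add (integrable_const _)) fun z => ?_
        have := abs_le.1 ((abs_rampLoss_sub_le (g z.1) (g' z.1) z.2).trans (h z.1))
        simp only
        linarith
    _ = _ := by rw [integral_add (hi hg') (integrable_const _)]; simp [expLoss]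

lemma measurable_apply_self {m : ℕ} {Z : Type*} [MeasurableSpace Z] (G : (Fin m → Z) → Z → ℝ)
    (hG : Measurable fun p : (Fin m → Z) × Z => G p.1 p.2) (i : Fin m) :
    Measurable fun S : Fin m → Z => G S (S i) :=
  hG.comp (measurable_id.prodMk (measurable_pi_apply i))

/-- The expected loss of approximate empirical risk minimization over a uniformly dense sequence
of a class with small Rademacher averages. -/
lemma integral_expLoss_nearMinimizer_le {H : Set (X → ℝ)} (hH : ∀ g ∈ H, Measurable g)
    (hne : H.Nonempty) {h : ℕ → X → ℝ} (hmeas : ∀ n, Measurable (h n)) (hhH : ∀ n, h n ∈ H)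
    (hdense : ∀ g ∈ H, ∀ η > 0, ∃ n, ∀ x, |h n x - g x| ≤ η)
    {τ : ℝ} (hτ : 0 < τ) {r : ℝ} {m : ℕ} (hm : 1 ≤ m)
    (hr : ∀ (z : Fin m → X × Label) (s : (Fin m → Bool) → X → ℝ), (∀ σ, s σ ∈ H) →
      signAvg (fun σ => ∑ i, sgn (σ i) * rampLoss (s σ (z i).1) (z i).2) ≤ m * r)
    (D : Measure (X × Label)) [IsProbabilityMeasure D] :
    Measurable (fun S : Fin m → X × Label => expLoss (h (nearMinimizer h hτ S)) D) ∧
    ∫ S, expLoss (h (nearMinimizer h hτ S)) D ∂(Measure.pi fun _ : Fin m => D) ≤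
      optLoss H D + (3 * τ + 2 * r) := by
  set μ := Measure.pi fun _ : Fin m => D with hμ
  let G : (Fin m → X × Label) → X × Label → ℝ := fun S z =>
    rampLoss (h (nearMinimizer h hτ S) z.1) z.2
  have hG : Measurable fun p : (Fin m → X × Label) × (X × Label) => G p.1 p.2 :=
    measurable_rampLoss.comp
      ((measurable_eval_nearMinimizer hmeas hτ measurable_fst
        (measurable_fst.comp measurable_snd)).prodMk
        (measurable_subtype_coe.comp (measurable_snd.comp measurable_snd)))
  have hG0 : ∀ S z, 0 ≤ G S z := fun _ _ => rampLoss_nonneg _ _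
  have hG1 : ∀ S z, G S z ≤ 1 := fun _ _ => rampLoss_le_one _ _
  have hgap := generalization_gap_le D G hG hG0 hG1 (r := m * r)
    (fun z s => hr z (fun σ => h (nearMinimizer h hτ (s σ))) fun σ => hhH _)
  rw [← hμ] at hgap
  refine ⟨hG.stronglyMeasurable.integral_prod_right'.measurable, ?_⟩
  change ∫ S, ∫ z, G S z ∂D ∂μ ≤ _
  have hmpos : (1 : ℝ) ≤ m := by exact_mod_cast hm
  generalize ∫ S, ∫ z, G S z ∂D ∂μ = I at hgap ⊢
  have hEmp : ∀ n, I ≤ expLoss (h n) D + τ + 2 * r := by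
    intro n
    have h1 : ∫ S, ∑ i, G S (S i) ∂μ ≤ ∫ S, (empLoss (h n) S + τ) ∂μ := by
      refine integral_mono ?_ ((integrable_empLoss (hmeas n) D m).add (integrable_const _))
        fun S => ?_
      swap
      · exact nearMinimizer_spec h hτ S n
      exact integrable_finsetSum _ fun i _ => integrable_of_unit
        (measurable_apply_self G hG i) (fun _ => hG0 _ _) (fun _ => hG1 _ _)
    rw [integral_add (integrable_empLoss (hmeas n) D m) (integrable_const _),
      integral_empLoss (hmeas n)] at h1
    simp only [integral_const, probReal_univ, one_smul] at h1
    -- The slack `τ` is on the total loss, hence at most `m * τ` since `1 ≤ m`.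
    have h2 : (m : ℝ) * I ≤ m * (expLoss (h n) D + τ + 2 * r) := by
      have := mul_le_mul_of_nonneg_right hmpos hτ.le
      linarith
    exact le_of_mul_le_mul_left h2 (by linarith)
  have hne' : Nonempty H := hne.to_subtype
  -- The other two `τ` come from a nearly optimal `g` and its approximation by the sequence.
  obtain ⟨g, hg⟩ := exists_lt_of_ciInf_lt
    (lt_add_of_pos_right (⨅ g : H, expLoss (g : X → ℝ) D) hτ)
  obtain ⟨n, hn⟩ := hdense g g.2 τ hτ
  have h1 := expLoss_le_add (hmeas n) (hH _ g.2) hn D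
  have h2 := hEmp n
  unfold optLoss
  linarith

/-- Markov's inequality for the excess of a nonnegative random loss over its optimum. -/
lemma one_sub_le_measureReal_of_integral_le {Ω : Type*} [MeasurableSpace Ω] {P : Measure Ω}
    [IsProbabilityMeasure P] {V : Ω → ℝ} (hVm : Measurable V) (hVi : Integrable V P) {o ε δ : ℝ}
    (hε : 0 < ε) (ho : ∀ ω, o ≤ V ω) (hE : ∫ ω, V ω ∂P ≤ o + δ * ε) :
    1 - δ ≤ P.real {ω | V ω ≤ o + ε} := by
  have hi : Integrable (fun ω => V ω - o) P := hVi.sub (integrable_const _)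
  have hmarkov := mul_meas_ge_le_integral_of_nonneg
    (Filter.Eventually.of_forall fun ω => sub_nonneg.2 (ho ω)) hi ε
  rw [integral_sub hVi (integrable_const _)] at hmarkov
  simp only [integral_const, probReal_univ, one_smul] at hmarkov
  have hPle : P.real {ω | ε ≤ V ω - o} ≤ δ := by
    have : ε * P.real {ω | ε ≤ V ω - o} ≤ ε * δ := by linarith
    exact le_of_mul_le_mul_left this hε
  have hset : MeasurableSet {ω | V ω ≤ o + ε} := measurableSet_le hVm measurable_const
  have hcompl := probReal_compl_eq_one_sub (μ := P) hset
  have hle : P.real {ω | V ω ≤ o + ε}ᶜ ≤ P.real {ω | ε ≤ V ω - o} := by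
    refine measureReal_mono fun ω hω => ?_
    simp only [Set.mem_compl_iff, Set.mem_ofPred_eq, not_le] at hω
    simp only [Set.mem_ofPred_eq]
    linarith
  linarith

/-- Approximate empirical risk minimization over a uniformly dense sequence of a class with small
Rademacher averages learns the class. -/
lemma erm_learns {H : Set (X → ℝ)} (hH : ∀ g ∈ H, Measurable g) (hne : H.Nonempty) {h : ℕ → X → ℝ}
    (hmeas : ∀ n, Measurable (h n)) (hhH : ∀ n, h n ∈ H)
    (hdense : ∀ g ∈ H, ∀ η > 0, ∃ n, ∀ x, |h n x - g x| ≤ η)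
    {τ : ℝ} (hτ : 0 < τ) {ε δ r : ℝ} (hε : 0 < ε) {m : ℕ} (hm : 1 ≤ m)
    (hr : ∀ (z : Fin m → X × Label) (s : (Fin m → Bool) → X → ℝ), (∀ σ, s σ ∈ H) →
      signAvg (fun σ => ∑ i, sgn (σ i) * rampLoss (s σ (z i).1) (z i).2) ≤ m * r)
    (hsmall : 3 * τ + 2 * r ≤ δ * ε) :
    (erm h hmeas hτ).Learns H ε δ m := by
  intro D hD
  obtain ⟨hVm, hVE⟩ := integral_expLoss_nearMinimizer_le hH hne hmeas hhH hdense hτ hm hr D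
  let V : (Fin m → X × Label) → ℝ := fun S => expLoss (h (nearMinimizer h hτ S)) D
  have hVi : Integrable V (Measure.pi fun _ : Fin m => D) :=
    integrable_of_unit hVm (fun _ => expLoss_nonneg _ _) fun S => expLoss_le_one (hmeas _) D
  let P := (Measure.pi fun _ : Fin m => D).prod (Measure.dirac ())
  have hPi : Integrable (fun p : (Fin m → X × Label) × Unit => V p.1) P := hVi.comp_fst _
  have hPE : ∫ p : (Fin m → X × Label) × Unit, V p.1 ∂P ≤ optLoss H D + δ * ε := by
    rw [integral_prod _ hPi]
    simp only [integral_const, probReal_univ, one_smul]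
    linarith
  exact one_sub_le_measureReal_of_integral_le (hVm.comp measurable_fst) hPi hε
    (fun p => ciInf_le (bddBelow_expLoss H D) (⟨_, hhH (nearMinimizer h hτ p.1)⟩ : H)) hPE

end ERM

/-! ### Density and the degenerate case of the class -/

lemma measurable_of_mem_H10 {d k : ℕ} {B : ℝ} {g : Cube d → ℝ} (hg : g ∈ H10 d k B) :
    Measurable g := by
  obtain ⟨wa, wb, -, -, rfl⟩ := hg
  exact Finset.measurable_sum _ fun j _ =>
    ((measurable_pi_apply j).comp measurable_subtype_coe).const_mul _

lemma zero_mem_H10 (d k : ℕ) {B : ℝ} (hB : 0 ≤ B) : (0 : Cube d → ℝ) ∈ H10 d k B :=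
  ⟨0, 0, by simpa using hB, by simp, by funext x; simp⟩

/-- `H10` has a sequence that is dense for the supremum norm. -/
lemma exists_dense_seq_H10 (d k : ℕ) {B : ℝ} (hB : 0 ≤ B) : ∃ h : ℕ → Cube d → ℝ,
    (∀ n, h n ∈ H10 d k B) ∧
      ∀ g ∈ H10 d k B, ∀ η > 0, ∃ n, ∀ x, |h n x - g x| ≤ η := by
  let P := {w : (Fin d → ℝ) × (Fin d → ℝ) // ∑ j, |w.1 j| ≤ B ∧ {j | w.2 j ≠ 0}.ncard ≤ k}
  have : Nonempty P := ⟨⟨0, by simpa using hB⟩⟩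
  let F : P → Cube d → ℝ := fun w x => ∑ j, (w.1.1 j + w.1.2 j) * x.1 j
  refine ⟨fun n => F (TopologicalSpace.denseSeq P n), fun n =>
    ⟨_, _, (TopologicalSpace.denseSeq P n).2.1, (TopologicalSpace.denseSeq P n).2.2, rfl⟩, ?_⟩
  rintro _ ⟨wa, wb, ha, hb, rfl⟩ η hη
  -- On the cube, the `ℓ1` distance of the weights dominates the sup distance of the predictors.
  let N : P → ℝ := fun w => ∑ j, |(w.1.1 j + w.1.2 j) - (wa j + wb j)|
  have hN : Continuous N := by fun_prop
  obtain ⟨n, hw⟩ := (TopologicalSpace.denseRange_denseSeq P).exists_mem_open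
    (isOpen_Iio.preimage hN : IsOpen (N ⁻¹' Set.Iio η)) ⟨⟨(wa, wb), ha, hb⟩, by simpa [N] using hη⟩
  refine ⟨n, fun x => ?_⟩
  refine le_trans ?_ (le_of_lt hw)
  simp only [F, ← Finset.sum_sub_distrib, ← sub_mul]
  refine (Finset.abs_sum_le_sum_abs _ _).trans (Finset.sum_le_sum fun j _ => ?_)
  rw [abs_mul]
  exact mul_le_of_le_one_right (abs_nonneg _) (x.2 j)

lemma half_le_log {x : ℝ} (hx : 2 ≤ x) : 1 / 2 ≤ Real.log x := by
  have h1 := Real.log_two_gt_d9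
  have h2 := Real.log_le_log two_pos hx
  linarith

lemma sampleComplexity_le {X : Type} [MeasurableSpace X] {H : Set (X → ℝ)} {ε δ : ℝ} {n : ℕ}
    (A : Algorithm X) (h : ∀ m, n ≤ m → A.Learns H ε δ m) : sampleComplexity H ε δ ≤ n :=
  (iInf_le _ A).trans (sInf_le ⟨n, h, rfl⟩)

lemma abs_le_of_mem_H10_zero {d : ℕ} {B : ℝ} {g : Cube d → ℝ} (hg : g ∈ H10 d 0 B) (x : Cube d) :
    |g x| ≤ B := by
  obtain ⟨wa, wb, ha, hb, rfl⟩ := hg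
  have hb0 : ∀ j, wb j = 0 := by
    have h := (Set.ncard_eq_zero (Set.toFinite _)).1 (Nat.le_zero.1 hb)
    intro j
    by_contra hj
    exact (Set.eq_empty_iff_forall_notMem.1 h j) hj
  simp only [hb0, add_zero]
  refine (Finset.abs_sum_le_sum_abs _ _).trans (le_trans (Finset.sum_le_sum fun j _ => ?_) ha)
  rw [abs_mul]
  exact mul_le_of_le_one_right (abs_nonneg _) (x.2 j)

/-- Without a sparse part and with weights of `ℓ1` norm at most `ε`, the zero predictor learns
without examples. -/
lemma sampleComplexity_H10_eq_zero {d : ℕ} {B ε δ : ℝ} (hB : 0 ≤ B) (hBε : B ≤ ε) (hδ : 0 < δ) :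
    sampleComplexity (H10 d 0 B) ε δ = 0 := by
  refine le_antisymm ?_ zero_le
  refine sampleComplexity_le (n := 0)
    (erm (fun _ => (0 : Cube d → ℝ)) (fun _ => measurable_const) one_pos) ?_
  intro m _ D hD
  have hne : Nonempty (H10 d 0 B) := ⟨⟨0, zero_mem_H10 d 0 hB⟩⟩
  have hopt : expLoss (0 : Cube d → ℝ) D ≤ optLoss (H10 d 0 B) D + ε := by
    rw [← sub_le_iff_le_add]
    refine le_ciInf fun g => ?_
    rw [sub_le_iff_le_add]
    refine expLoss_le_add measurable_const (measurable_of_mem_H10 g.2) (fun x => ?_) D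
    change |(0 : ℝ) - g.1 x| ≤ ε
    rw [zero_sub, abs_neg]
    exact (abs_le_of_mem_H10_zero g.2 x).trans hBε
  have hset : {p : (Fin m → Cube d × Label) × Unit |
      expLoss (0 : Cube d → ℝ) D ≤ optLoss (H10 d 0 B) D + ε} = Set.univ :=
    Set.eq_univ_of_forall fun _ => hopt
  change 1 - δ ≤ ((Measure.pi fun _ : Fin m => D).prod (Measure.dirac ())).real
    {p : (Fin m → Cube d × Label) × Unit |
      expLoss (0 : Cube d → ℝ) D ≤ optLoss (H10 d 0 B) D + ε}
  rw [hset, probReal_univ]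
  linarith

/-! ### Sample size arithmetic -/

/-- The two conclusions serve the `ℓ1` part and the sparse part. The second is implicit in `m`
through `log m`. -/
lemma exists_sampleSize_const {δ : ℝ} (hδ : 0 < δ) (hδ1 : δ < 1) : ∃ C : ℝ, 0 < C ∧
    ∀ R m : ℝ, 0 < R → 0 < m → C * R * Real.log (2 + R) ≤ m → 324 * R ≤ m * δ ^ 2 ∧
      162 * R * (1 + 4 * (Real.log m + Real.log (42 / δ) + 2 * Real.log (2 + R))) ≤ m * δ ^ 2 := by
  have hδ2 : 0 < δ ^ 2 := by positivity
  have hδ21 : δ ^ 2 ≤ 1 := by nlinarith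
  have hp : 0 ≤ Real.log (42 / δ) := Real.log_nonneg (by rw [le_div_iff₀ hδ]; linarith)
  have hq : 0 ≤ Real.log (2592 / δ ^ 2) := Real.log_nonneg (by rw [le_div_iff₀ hδ2]; linarith)
  set p := Real.log (42 / δ)
  set q := Real.log (2592 / δ ^ 2) with hqdef
  refine ⟨(648 + 324 * (10 + 8 * p) + 2592 * (2 * q + 1)) / δ ^ 2, by positivity,
    fun R m hR hm h => ?_⟩
  set Λ := Real.log (2 + R) with hΛ
  have hΛ2 : 1 / 2 ≤ Λ := half_le_log (by linarith)
  have h' : (648 + 324 * (10 + 8 * p) + 2592 * (2 * q + 1)) * (R * Λ) ≤ m * δ ^ 2 := by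
    have e : (648 + 324 * (10 + 8 * p) + 2592 * (2 * q + 1)) * (R * Λ) =
      (648 + 324 * (10 + 8 * p) + 2592 * (2 * q + 1)) / δ ^ 2 * R * Λ * δ ^ 2 := by field_simp
    rw [e]
    exact mul_le_mul_of_nonneg_right h hδ2.le
  have hRΛ : R ≤ 2 * (R * Λ) := by nlinarith
  have hRΛ0 : 0 < R * Λ := by positivity
  have hpR : p * R ≤ 2 * (p * (R * Λ)) := by nlinarith
  have hqR : q * R ≤ 2 * (q * (R * Λ)) := by nlinarith
  have hp0 : 0 ≤ p * (R * Λ) := by positivity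
  have hq0 : 0 ≤ q * (R * Λ) := by positivity
  refine ⟨by linarith, ?_⟩
  have hlog : 1296 * (R * Real.log m) ≤ m * δ ^ 2 / 2 + 1296 * (R * (q + Λ)) := by
    -- Splitting `m` this way and using `log x ≤ x - 1` on the first factor absorbs `log m` into
    -- half of the right-hand side.
    have e : m = m * δ ^ 2 / (2592 * R) * (2592 / δ ^ 2 * R) := by field_simp
    have h1 : Real.log m ≤ m * δ ^ 2 / (2592 * R) + (q + Λ) := by
      conv_lhs => rw [e]
      rw [Real.log_mul (by positivity) (by positivity), Real.log_mul (by positivity) hR.ne']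
      have h2 := Real.log_le_sub_one_of_pos (x := m * δ ^ 2 / (2592 * R)) (by positivity)
      have h3 : Real.log R ≤ Λ := Real.log_le_log hR (by linarith)
      linarith
    have h2 := mul_le_mul_of_nonneg_left h1 (by positivity : 0 ≤ 1296 * R)
    have e2 : 1296 * R * (m * δ ^ 2 / (2592 * R) + (q + Λ)) =
        m * δ ^ 2 / 2 + 1296 * (R * (q + Λ)) := by field_simp; ring
    linarith
  linarith

/-- The grid size is polynomial in `2 + R` for fixed `δ`, so its logarithm brings no separate
dependence on `B` or `ε`. -/
lemma gridSize_le {B ε δ R : ℝ} (hδ : 0 < δ) (hδ1 : δ < 1) (hε : 0 < ε) (hε1 : ε < 1) (hB : 0 ≤ B)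
    (hBR : B + 1 ≤ 2 + R) (hinv : 1 ≤ 2 * (2 + R) * ε) :
    (⌈2 * (B + 1) / (δ * ε / 9)⌉₊ : ℝ) + 2 ≤ 42 / δ * (2 + R) ^ 2 := by
  have hδε : 0 < δ * ε := mul_pos hδ hε
  have hδε1 : δ * ε ≤ 1 := mul_le_one₀ hδ1.le hε.le hε1.le
  have c1 := Nat.ceil_lt_add_one (by positivity : 0 ≤ 2 * (B + 1) / (δ * ε / 9))
  have c4 : 2 * (B + 1) / (δ * ε / 9) = 18 * ((B + 1) / (δ * ε)) := by field_simp; norm_num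
  have c5 : 1 ≤ (B + 1) / (δ * ε) := by
    rw [le_div_iff₀ hδε]
    linarith
  have c8 : (B + 1) / (δ * ε) ≤ 2 / δ * (2 + R) ^ 2 := by
    rw [div_le_iff₀ hδε]
    have c7 : 2 / δ * (2 + R) ^ 2 * (δ * ε) = (2 + R) * (2 * (2 + R) * ε) := by
      field_simp
    rw [c7]
    have := mul_le_mul hBR hinv zero_le_one (by linarith)
    rwa [mul_one] at this
  have c9 : 42 / δ * (2 + R) ^ 2 = 21 * (2 / δ * (2 + R) ^ 2) := by ring
  rw [c9]
  linarith

/-- As `log d ≥ 1 / 2`, the sum `log d + 2 log A` is at most `log d * (1 + 4 log A)`, which isolates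
the factor `k log d` of the rate. -/
lemma sparse_entropy_le {d k m M δ R e : ℝ} (hd : 2 ≤ d) (hk : 1 ≤ k) (hm : 1 ≤ m) (hM : 0 ≤ M)
    (hδ : 0 < δ) (hR : 0 ≤ R) (he : 0 < e) (hkR : k * Real.log d ≤ R * e)
    (hMR : M + 2 ≤ 42 / δ * (2 + R) ^ 2)
    (h : 162 * R * (1 + 4 * (Real.log m + Real.log (42 / δ) + 2 * Real.log (2 + R))) ≤
      m * δ ^ 2) :
    k * Real.log (d * (m * (M + 1) + 1) ^ 2) ≤ m * δ ^ 2 * e / 162 := by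
  have hld := half_le_log hd
  have hA1 : 1 ≤ m * (M + 1) + 1 := le_add_of_nonneg_left (by positivity)
  have hAle : m * (M + 1) + 1 ≤ m * (42 / δ * (2 + R) ^ 2) :=
    (by linarith : m * (M + 1) + 1 ≤ m * (M + 2)).trans
      (mul_le_mul_of_nonneg_left hMR (by linarith))
  generalize m * (M + 1) + 1 = A at hA1 hAle ⊢
  have hlogA : Real.log A ≤ Real.log m + Real.log (42 / δ) + 2 * Real.log (2 + R) := by
    refine (Real.log_le_log (by linarith) hAle).trans_eq ?_
    rw [Real.log_mul (by positivity) (by positivity), Real.log_mul (by positivity)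
      (by positivity), Real.log_pow, Nat.cast_ofNat]
    ring
  have hlogA0 : 0 ≤ Real.log A := Real.log_nonneg hA1
  rw [Real.log_mul (by positivity) (by positivity), Real.log_pow, Nat.cast_ofNat]
  generalize Real.log m + Real.log (42 / δ) + 2 * Real.log (2 + R) = Y at hlogA h
  have s0 : 2 * Real.log A ≤ Real.log d * (4 * Real.log A) := by
    have := mul_le_mul_of_nonneg_right hld (by positivity : 0 ≤ 4 * Real.log A)
    linarith
  have s1 : k * (Real.log d + 2 * Real.log A) ≤ k * Real.log d * (1 + 4 * Real.log A) := by
    rw [mul_assoc]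
    exact mul_le_mul_of_nonneg_left (by linarith) (by linarith)
  have s2 : k * Real.log d * (1 + 4 * Real.log A) ≤ R * e * (1 + 4 * Y) :=
    mul_le_mul hkR (by linarith) (by linarith) (by positivity)
  have s3 := mul_le_mul_of_nonneg_right h he.le
  linarith

/-- Approximate empirical risk minimization over a dense sequence of `H10` learns from a sample
whose size is the rate up to a logarithmic factor. -/
lemma erm_H10_learns {d k m : ℕ} {B ε δ : ℝ} (hd : 2 ≤ d) (hB : 0 ≤ B) (hε : 0 < ε) (hε1 : ε < 1)
    (hδ : 0 < δ) (hδ1 : δ < 1) (hm : 1 ≤ m) (h1 : 324 * rate d k B ε ≤ m * δ ^ 2)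
    (h2 : 162 * rate d k B ε * (1 + 4 * (Real.log m + Real.log (42 / δ) +
      2 * Real.log (2 + rate d k B ε))) ≤ m * δ ^ 2)
    {h : ℕ → Cube d → ℝ} (hmeas : ∀ n, Measurable (h n)) (hhH : ∀ n, h n ∈ H10 d k B)
    (hdense : ∀ g ∈ H10 d k B, ∀ η > 0, ∃ n, ∀ x, |h n x - g x| ≤ η)
    (hτ : 0 < δ * ε / 9) : (erm h hmeas hτ).Learns (H10 d k B) ε δ m := by
  -- With `τ = δ * ε / 9` and `r = 3 * τ`, the total `3 * τ + 2 * r` is exactly `δ * ε`.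
  refine erm_learns (fun g hg => measurable_of_mem_H10 hg) ⟨_, zero_mem_H10 d k hB⟩ hmeas hhH
    hdense hτ (r := 3 * (δ * ε / 9)) hε hm ?_ (by linarith)
  set τ := δ * ε / 9 with hτdef
  set R := rate d k B ε with hR
  have hd' : (2 : ℝ) ≤ d := by exact_mod_cast hd
  have hld : 1 / 2 ≤ Real.log d := half_le_log hd'
  have hmR : (1 : ℝ) ≤ m := by exact_mod_cast hm
  have hε2 : 0 < ε ^ 2 := by positivity
  have hRe : R * ε ^ 2 = k * Real.log d + B ^ 2 * Real.log d := by
    rw [hR, rate]; field_simp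
  have hτ2 : m * τ ^ 2 / 2 = m * δ ^ 2 * ε ^ 2 / 162 := by rw [hτdef]; ring
  have hk0 : 0 ≤ k * Real.log d := by positivity
  have hB0 : 0 ≤ B ^ 2 * Real.log d := by positivity
  have hR0 : 0 ≤ R := by
    rw [hR, rate]; positivity
  have ha : B ^ 2 * Real.log (2 * d) ≤ m * τ ^ 2 / 2 := by
    have e1 : Real.log (2 * d) ≤ 2 * Real.log d := by
      rw [Real.log_mul two_ne_zero (by positivity)]
      linarith [Real.log_le_log two_pos hd']
    have e2 : B ^ 2 * Real.log (2 * d) ≤ B ^ 2 * (2 * Real.log d) :=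
      mul_le_mul_of_nonneg_left e1 (sq_nonneg B)
    have e3 := mul_le_mul_of_nonneg_right h1 hε2.le
    rw [hτ2]
    linarith
  set M := ⌈2 * (B + 1) / τ⌉₊ with hMdef
  have hM : 2 * (B + 1) ≤ M * τ := by
    have := Nat.le_ceil (2 * (B + 1) / τ)
    rwa [div_le_iff₀ hτ] at this
  have hb : k * Real.log (d * (m * (M + 1) + 1) ^ 2) ≤ m * τ ^ 2 / 2 := by
    rcases Nat.eq_zero_or_pos k with rfl | hk
    · rw [Nat.cast_zero, zero_mul]; positivity
    have hk1 : (1 : ℝ) ≤ k := by exact_mod_cast hk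
    have hkl : 1 / 2 ≤ k * Real.log d := by nlinarith
    have hRε : 1 / 2 ≤ R * ε ^ 2 := by linarith
    have hinv : 1 ≤ 2 * (2 + R) * ε := by nlinarith
    have hε21 : ε ^ 2 ≤ 1 := by nlinarith
    have hBR : B + 1 ≤ 2 + R := by nlinarith
    have hM2 : (M : ℝ) + 2 ≤ 42 / δ * (2 + R) ^ 2 := gridSize_le hδ hδ1 hε hε1 hB hBR hinv
    rw [hτ2]
    exact sparse_entropy_le hd' hk1 hmR (Nat.cast_nonneg M) hδ hR0 hε2 (by linarith) hM2 h2
  intro z s hs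
  refine (signAvg_rampLoss_le (by omega) hB hτ hM ha hb z s hs).trans_eq (by ring)

end RulesFirst

theorem theorem2 :
    ∃ c : ℕ, ∀ δ : ℝ, 0 < δ → δ < 1 →
      ∃ C : ℝ, 0 < C ∧
        ∀ (d k : ℕ) (B ε : ℝ), 2 ≤ d → 0 ≤ B → 0 < ε → ε < 1 →
          ∃ n : ℕ, RulesFirst.sampleComplexity (RulesFirst.H10 d k B) ε δ = (n : ℕ∞) ∧
            (n : ℝ) ≤ C * RulesFirst.rate d k B ε *
              Real.log (2 + RulesFirst.rate d k B ε) ^ c := by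
  refine ⟨1, fun δ hδ hδ1 => ?_⟩
  obtain ⟨C, hC, hCm⟩ := RulesFirst.exists_sampleSize_const hδ hδ1
  refine ⟨C + 4, by linarith, fun d k B ε hd hB hε hε1 => ?_⟩
  have hld : 1 / 2 ≤ Real.log d := RulesFirst.half_le_log (by exact_mod_cast hd)
  have hR0 : 0 ≤ RulesFirst.rate d k B ε := by unfold RulesFirst.rate; positivity
  rw [pow_one]
  -- Here the rate may be arbitrarily small, so the bound may be below one and no example is
  -- affordable. In all other cases the rate is at least `1 / 2`.
  by_cases htriv : k = 0 ∧ B ≤ ε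
  · obtain ⟨rfl, hBε⟩ := htriv
    refine ⟨0, by rw [RulesFirst.sampleComplexity_H10_eq_zero hB hBε hδ]; rfl, ?_⟩
    have : 0 ≤ Real.log (2 + RulesFirst.rate d 0 B ε) := Real.log_nonneg (by linarith)
    rw [Nat.cast_zero]
    positivity
  have hR : 1 / 2 ≤ RulesFirst.rate d k B ε := by
    unfold RulesFirst.rate
    rw [le_div_iff₀ (by positivity)]
    rcases Nat.eq_zero_or_pos k with rfl | hk
    · have hBε : ε < B := not_le.1 fun h => htriv ⟨rfl, h⟩
      have : ε ^ 2 ≤ B ^ 2 := by gcongr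
      rw [Nat.cast_zero, zero_mul, zero_add]
      nlinarith [sq_nonneg B]
    · have hk1 : (1 : ℝ) ≤ k := by exact_mod_cast hk
      have : ε ^ 2 ≤ 1 := by nlinarith
      have : 0 ≤ B ^ 2 * Real.log d := by positivity
      nlinarith
  set R := RulesFirst.rate d k B ε with hRdef
  have hΛ : 1 / 2 ≤ Real.log (2 + R) := RulesFirst.half_le_log (by linarith)
  set N := ⌈C * R * Real.log (2 + R)⌉₊ with hN
  have hpos : 0 < C * R * Real.log (2 + R) := by positivity
  have hN1 : 1 ≤ N := Nat.ceil_pos.2 hpos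
  obtain ⟨h, hhH, hdense⟩ := RulesFirst.exists_dense_seq_H10 d k hB
  have hle : RulesFirst.sampleComplexity (RulesFirst.H10 d k B) ε δ ≤ (N : ℕ∞) := by
    refine RulesFirst.sampleComplexity_le (RulesFirst.erm h
      (fun n => RulesFirst.measurable_of_mem_H10 (hhH n))
      (by positivity : 0 < δ * ε / 9)) fun m hm => ?_
    have hm1 : 1 ≤ m := hN1.trans hm
    obtain ⟨h1, h2⟩ := hCm R m (by linarith) (by exact_mod_cast hm1)
      ((Nat.le_ceil _).trans (by exact_mod_cast hm))
    exact RulesFirst.erm_H10_learns hd hB hε hε1 hδ hδ1 hm1 h1 h2 _ hhH hdense _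
  obtain ⟨n, hn⟩ := ENat.ne_top_iff_exists.1 (ne_top_of_le_ne_top (ENat.natCast_ne_top N) hle)
  refine ⟨n, hn.symm, ?_⟩
  have hnN : n ≤ N := by rw [← hn] at hle; exact_mod_cast hle
  have h3 : (n : ℝ) ≤ N := by exact_mod_cast hnN
  have h4 : (N : ℝ) < C * R * Real.log (2 + R) + 1 := Nat.ceil_lt_add_one hpos.le
  -- The rounding of `N` costs at most one, which the summand `4` of the constant pays for.
  have h5 : 1 ≤ 4 * (R * Real.log (2 + R)) := by nlinarith
  linarith
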